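/- **Setting.** Let $a<b$, $\kappa,\varepsilon>0$, $0<\alpha<1$, $u_0:\mathbb R\to\mathbb R$, and let $M,N\ge1$ be integers. *Time mesh.* Let $0=t_0<t_1<\dots<t_N$, $\tau_k=t_k-t_{k-1}$, $\tau_{\max}=\max_{1\le k\le N}\tau_k$, $\rho_1=0$, and assume $\rho_k=\tau_k/\tau_{k-1}\ge1$ for $2\le k\le N$. The value $\rho_{N+1}$, which occurs below but is not determined by the mesh, may be any real number $\ge0$. Write $\nabla_\tau w^k=w^k-w^{k-1}$. For $1\le k\le n\le N$ put $$c^{(n)}_{n-k}=\frac{(t_n-t_{k-1})^{1-\alpha}-(t_n-t_k)^{1-\alpha}}{\tau_k\Gamma(2-\alpha)},$$ $$d^{(n)}_{n-k}=\frac{2[(t_n-t_{k-1})^{2-\alpha}-(t_n-t_k)^{2-\alpha}]}{\tau_k^2\Gamma(3-\alpha)}-\frac{(t_n-t_{k-1})^{1-\alpha}+(t_n-t_k)^{1-\alpha}}{\tau_k\Gamma(2-\alpha)},$$ and define the kernels of the L2 formula by $$B^{(n)}_{n-k}=\begin{cases} c_0^{(1)}, & k=n=1,\\ c_1^{(2)}-\frac{d_1^{(2)}}{1+\rho_2}-\frac{\rho_2^2}{1+\rho_2}d_0^{(2)},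 & k=1,\ n=2,\\ c_0^{(n)}+\frac{d_1^{(n)}}{\rho_n(1+\rho_n)}+\frac{\rho_n}{1+\rho_n}d_0^{(n)}, & k=n\ge2,\\ c_{n-1}^{(n)}-\frac{d_{n-1}^{(n)}}{1+\rho_2}, & k=1,\ n\ge3,\\ c_1^{(n)}+\frac{d_2^{(n)}}{\rho_{n-1}(1+\rho_{n-1})}-\frac{d_1^{(n)}}{1+\rho_n}-\frac{\rho_n^2}{1+\rho_n}d_0^{(n)}, & k=n-1,\ n\ge3,\\ c_{n-k}^{(n)}+\frac{d_{n-k+1}^{(n)}}{\rho_k(1+\rho_k)}-\frac{d_{n-k}^{(n)}}{1+\rho_{k+1}}, & 2\le k\le n-2. \end{cases}$$ Let $\overline\rho$ be any real number with $|\overline\rho-4.7476114|\le10^{-7}$, and put $$\theta=\frac1{2-\alpha}+\frac{2^{1-\alpha}\alpha^2+\alpha-2\alpha^2}{2(2-\alpha)(1+\overline\rho)},\qquad q(z,y,\alpha)=2\theta(2-\alpha)+\frac{2\alpha z-\alpha z^{2-\alpha/2}}{1+z}-\frac{\alpha y^{2-\alpha/2}}{1+y}.$$ Put $J^{(1)}_0=2(1-\theta)c^{(1)}_0$,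 and for $n\ge2$ $$J^{(n)}_{n-k}=\begin{cases} 2\Big[(1-\theta)c^{(n)}_0+\frac{d^{(n)}_1}{\rho_n(1+\rho_n)}\Big], & k=n,\\ c^{(n)}_{n-1}-\frac{d^{(n)}_{n-1}}{1+\rho_2}, & k=1,\\ c^{(n)}_{n-k}+\frac{d^{(n)}_{n-k+1}}{\rho_k(1+\rho_k)}-\frac{d^{(n)}_{n-k}}{1+\rho_{k+1}}, & 2\le k\le n-1. \end{cases}$$ *Scheme.* Let $h=(b-a)/M$, $x_i=a+ih$, and let $\mathring{\mathcal U}_h$ be the space of grid functions $(w_0,\dots,w_M)$ with $w_0=w_M=0$. For $1\le i\le M-1$ let $(\mathscr A w)_i=\frac1{12}(w_{i-1}+10w_i+w_{i+1})$ and $(\delta_x^2w)_i=(w_{i-1}-2w_i+w_{i+1})/h^2$. With $f(u)=u^3-u$, let $u^0,\dots,u^N$ and $v^1,\dots,v^N$ in $\mathring{\mathcal U}_h$ satisfy, for $1\le i\le M-1$ and $1\le n\le N$, $$\mathscr A\sum_{k=1}^nB^{(n)}_{n-k}\nabla_\tau u^k_i=\kappa\,\delta_x^2f(u^n_i)+\kappa\varepsilon^2\delta_x^2v^n_i,\qquad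 \mathscr A v^n_i=-\delta_x^2u^n_i,\qquad u^0_i=u_0(x_i).$$ *Energy.* On $\mathring{\mathcal U}_h$, identified with the interior values, let $(\varphi,\psi)=h\sum_{i=1}^{M-1}\varphi_i\psi_i$, $\mathcal H=\mathscr A^{-1}\delta_x^2$, $\|\nabla_h\varphi\|^2=-(\mathcal H\varphi,\varphi)$ and $\|\varphi\|_{-\mathcal H}^2=(\varphi,(-\mathcal H)^{-1}\varphi)$. Put $$E^n=\frac{\varepsilon^2}2\|\nabla_hu^n\|^2+\frac h4\sum_{i=1}^{M-1}\big((u_i^n)^2-1\big)^2,\qquad \mathcal E^n=E^n+\frac1\kappa\big(\mathcal G[\nabla_\tau u^n],1\big)_{-\mathcal H},$$ where $(\mathcal G[\nabla_\tau u^n],1)_{-\mathcal H}$ denotes $$\frac{\alpha\,\rho_{n+1}^{2-\alpha/2}\,\|\nabla_\tau u^n\|_{-\mathcal H}^2}{2(1+\rho_{n+1})\tau_n^\alpha\Gamma(3-\alpha)}+\frac12\sum_{j=1}^{n-1}\big(J^{(n)}_{n-j-1}-J^{(n)}_{n-j}\big)\|u^n-u^j\|_{-\mathcal H}^2+\frac12J^{(n)}_{n-1}\|u^n-u^0\|_{-\mathcal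 H}^2 .$$ **Theorem.** Suppose that $$\tau_{\max}\le\Big(\frac{(2-\alpha+2\rho_n)h^2}{12\kappa(1+\rho_n)\Gamma(3-\alpha)}\Big)^{1/\alpha}\quad(1\le n\le N) \qquad\text{and}\qquad \tau_n^\alpha\le\frac{4\varepsilon^2q(\rho_n,\rho_{n+1},\alpha)}{\kappa\Gamma(3-\alpha)}\quad(2\le n\le N).$$ Then $\mathcal E^n\le\mathcal E^{n-1}$ for all $2\le n\le N$. -/

import Mathlib

open scoped BigOperators Matrix

noncomputable section

namespace TFCH

/-! ### Time mesh

A time mesh is given by its nodes `t 0 < t 1 < ⋯ < t N`. -/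

/-- Step size `τ_k = t_k - t_{k-1}` (used for `k ≥ 1`). -/
def tau (t : ℕ → ℝ) (k : ℕ) : ℝ := t k - t (k - 1)

/-- Adjacent step ratios: `ρ_1 = 0` and `ρ_k = τ_k / τ_{k-1}` for `2 ≤ k ≤ N`.
The mesh has no step number `N + 1`; the value `ρ_{N+1}`, which enters the functional `𝓖` and the
step size restriction at the last level, is the parameter `r`. -/
def rho (t : ℕ → ℝ) (N : ℕ) (r : ℝ) (k : ℕ) : ℝ :=
  if k ≤ 1 then 0 else if k ≤ N then tau t k / tau t (k - 1) else r

/-- Backward difference `∇_τ w^k = w^k - w^{k-1}` (used for `k ≥ 1`). -/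
def bdiff {V : Type*} [AddCommGroup V] (w : ℕ → V) (k : ℕ) : V := w k - w (k - 1)

/-! ### Kernels of the L2 formula

The kernel with subscript `n - k` and superscript `(n)` is written with the arguments `n k`. -/

/-- `c_{n-k}^{(n)}`. -/
def kerC (α : ℝ) (t : ℕ → ℝ) (n k : ℕ) : ℝ :=
  ((t n - t (k - 1)) ^ (1 - α) - (t n - t k) ^ (1 - α)) / (tau t k * Real.Gamma (2 - α))

/-- `d_{n-k}^{(n)}`. -/
def kerD (α : ℝ) (t : ℕ → ℝ) (n k : ℕ) : ℝ :=
  2 * ((t n - t (k - 1)) ^ (2 - α) - (t n - t k) ^ (2 - α)) / (tau t k ^ 2 * Real.Gamma (3 - α))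
    - ((t n - t (k - 1)) ^ (1 - α) + (t n - t k) ^ (1 - α)) / (tau t k * Real.Gamma (2 - α))

/-- The discrete kernels `B_{n-k}^{(n)}`, `1 ≤ k ≤ n`, of the L2 approximation
`∑_{k=1}^n B_{n-k}^{(n)} ∇_τ w^k` of the Caputo derivative at `t_n`. Here `ρ` are the step ratios. -/
def kerB (α : ℝ) (t ρ : ℕ → ℝ) (n k : ℕ) : ℝ :=
  if k = n then
    if n = 1 then kerC α t 1 1
    else kerC α t n n + kerD α t n (n - 1) / (ρ n * (1 + ρ n))
      + ρ n / (1 + ρ n) * kerD α t n n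
  else if k = 1 then
    if n = 2 then
      kerC α t 2 1 - kerD α t 2 1 / (1 + ρ 2) - ρ 2 ^ 2 / (1 + ρ 2) * kerD α t 2 2
    else kerC α t n 1 - kerD α t n 1 / (1 + ρ 2)
  else if k = n - 1 then
    kerC α t n k + kerD α t n (k - 1) / (ρ k * (1 + ρ k))
      - kerD α t n k / (1 + ρ n) - ρ n ^ 2 / (1 + ρ n) * kerD α t n n
  else
    kerC α t n k + kerD α t n (k - 1) / (ρ k * (1 + ρ k)) - kerD α t n k / (1 + ρ (k + 1))

/-- The splitting parameter `θ`, for a given value `ρbar` of the constant `≈ 4.7476114`. -/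
def theta (α ρbar : ℝ) : ℝ :=
  1 / (2 - α) +
    ((2 : ℝ) ^ (1 - α) * α ^ 2 + α - 2 * α ^ 2) / (2 * (2 - α) * (1 + ρbar))

/-- The function `q(z, y, α)`. -/
def qFun (α ρbar z y : ℝ) : ℝ :=
  2 * theta α ρbar * (2 - α) + (2 * α * z - α * z ^ (2 - α / 2)) / (1 + z)
    - α * y ^ (2 - α / 2) / (1 + y)

/-- The split kernels `c̃_{n-k}^{(n)}`, `1 ≤ k ≤ n`. -/
def kerCt (α ρbar : ℝ) (t ρ : ℕ → ℝ) (n k : ℕ) : ℝ :=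
  if k = n then
    if n = 1 then (1 - theta α ρbar) * kerC α t 1 1
    else (1 - theta α ρbar) * kerC α t n n + kerD α t n (n - 1) / (ρ n * (1 + ρ n))
  else if k = 1 then kerC α t n 1 - kerD α t n 1 / (1 + ρ 2)
  else
    kerC α t n k + kerD α t n (k - 1) / (ρ k * (1 + ρ k)) - kerD α t n k / (1 + ρ (k + 1))

/-- The auxiliary kernels `J_0^{(n)} = 2 c̃_0^{(n)}` and `J_{n-k}^{(n)} = c̃_{n-k}^{(n)}`, `k < n`. -/
def kerJ (α ρbar : ℝ) (t ρ : ℕ → ℝ) (n k : ℕ) : ℝ :=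
  if k = n then 2 * kerCt α ρbar t ρ n n else kerCt α ρbar t ρ n k

/-- The functional `𝓖[∇_τ w^n]` for a sequence `w` in a vector space `V`, where `sq` is the square
in use. For `V = ℝ` and `sq x = x ^ 2` it is the scalar functional. For grid functions, with
`sq φ = (φ, φ)_{-𝓗}`, it is the quantity written `(𝓖[∇_τ w^n], 1)_{-𝓗}`: every square `φ ^ 2` in the
scalar functional stands for `φ · φ`, paired in the `-𝓗` inner product. -/
def calG {V : Type*} [AddCommGroup V] (sq : V → ℝ) (α ρbar : ℝ) (t ρ : ℕ → ℝ)
    (w : ℕ → V) (n : ℕ) : ℝ :=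
  α * ρ (n + 1) ^ (2 - α / 2) * sq (bdiff w n)
      / (2 * (1 + ρ (n + 1)) * tau t n ^ α * Real.Gamma (3 - α))
    + 1 / 2 * ∑ j ∈ Finset.Icc 1 (n - 1),
        (kerJ α ρbar t ρ n (j + 1) - kerJ α ρbar t ρ n j) * sq (w n - w j)
    + 1 / 2 * kerJ α ρbar t ρ n 1 * sq (w n - w 0)

/-! ### Space grid

A grid function is given by its values `w i` at the nodes `x_i = a + i h`, `0 ≤ i ≤ M`. -/

/-- `𝒜 w` at an interior node `1 ≤ i ≤ M - 1`. -/
def avg (w : ℕ → ℝ) (i : ℕ) : ℝ := (w (i - 1) + 10 * w i + w (i + 1)) / 12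

/-- `δ_x² w` at an interior node `1 ≤ i ≤ M - 1`. -/
def lap (h : ℝ) (w : ℕ → ℝ) (i : ℕ) : ℝ := (w (i - 1) - 2 * w i + w (i + 1)) / h ^ 2

/-- The interior values `(w_1, …, w_{M-1})`; they determine a grid function with `w_0 = w_M = 0`. -/
def interiorVals (M : ℕ) (w : ℕ → ℝ) : Fin (M - 1) → ℝ := fun j => w (j + 1)

/-- The matrix of `𝒜` on grid functions vanishing at the boundary. -/
def avgMat (M : ℕ) : Matrix (Fin (M - 1)) (Fin (M - 1)) ℝ :=
  Matrix.of fun i j =>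
    if i = j then 10 / 12 else if (i : ℕ) + 1 = j ∨ (j : ℕ) + 1 = i then 1 / 12 else 0

/-- The matrix of `δ_x²` on grid functions vanishing at the boundary. -/
def lapMat (M : ℕ) (h : ℝ) : Matrix (Fin (M - 1)) (Fin (M - 1)) ℝ :=
  Matrix.of fun i j =>
    if i = j then -2 / h ^ 2 else if (i : ℕ) + 1 = j ∨ (j : ℕ) + 1 = i then 1 / h ^ 2 else 0

/-- `𝓗 = 𝒜⁻¹ δ_x²` on grid functions vanishing at the boundary. -/
def calH (M : ℕ) (h : ℝ) : Matrix (Fin (M - 1)) (Fin (M - 1)) ℝ := (avgMat M)⁻¹ * lapMat M h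

/-- `(φ, ψ) = h ∑_{i=1}^{M-1} φ_i ψ_i`. -/
def ip {M : ℕ} (h : ℝ) (φ ψ : Fin (M - 1) → ℝ) : ℝ := h * ∑ i, φ i * ψ i

/-- `(φ, ψ)_{-𝓗} = (φ, (-𝓗)⁻¹ ψ)`. -/
def ipNegH {M : ℕ} (h : ℝ) (φ ψ : Fin (M - 1) → ℝ) : ℝ := ip h φ ((-calH M h)⁻¹ *ᵥ ψ)

/-- `‖∇_h φ‖²`. A discrete gradient satisfies `(𝓗 φ, ψ) = -(∇_h φ, ∇_h ψ)`,
so that `‖∇_h φ‖² = -(𝓗 φ, φ)`. -/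
def gradNormSq {M : ℕ} (h : ℝ) (φ : Fin (M - 1) → ℝ) : ℝ := -ip h (calH M h *ᵥ φ) φ

/-- The discrete free energy `(ε² / 2) ‖∇_h φ‖² + (1 / 4) ‖φ^{∘2} - 1‖²`. -/
def freeEnergy {M : ℕ} (h ε : ℝ) (φ : Fin (M - 1) → ℝ) : ℝ :=
  ε ^ 2 / 2 * gradNormSq h φ
    + 1 / 4 * ip h (fun i => φ i ^ 2 - 1) (fun i => φ i ^ 2 - 1)

/-- The modified discrete energy `𝓔^n = E^n + (1 / κ) (𝓖[∇_τ u^n], 1)_{-𝓗}`. -/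
def modEnergy (M : ℕ) (h ε κ α ρbar : ℝ) (t ρ : ℕ → ℝ) (u : ℕ → ℕ → ℝ) (n : ℕ) : ℝ :=
  freeEnergy h ε (interiorVals M (u n))
    + 1 / κ * calG (fun φ => ipNegH h φ φ) α ρbar t ρ (fun k => interiorVals M (u k)) n

/-- The nonlinearity `f(u) = u³ - u`. -/
def fNl (x : ℝ) : ℝ := x ^ 3 - x

/-- `u`, `v` solve the fully discrete compact difference scheme on the grid `x_i = a + i (b - a) / M`
with time levels `0, …, N`; `u n i` is `u_i^n`, and `u^n`, `v^n` vanish at the boundary nodes. -/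
structure IsSchemeSolution (a b : ℝ) (M N : ℕ) (κ ε α : ℝ) (t ρ : ℕ → ℝ) (u₀ : ℝ → ℝ)
    (u v : ℕ → ℕ → ℝ) : Prop where
  u_left : ∀ n ≤ N, u n 0 = 0
  u_right : ∀ n ≤ N, u n M = 0
  v_left : ∀ n, 1 ≤ n → n ≤ N → v n 0 = 0
  v_right : ∀ n, 1 ≤ n → n ≤ N → v n M = 0
  evolution : ∀ n, 1 ≤ n → n ≤ N → ∀ i, 1 ≤ i → i ≤ M - 1 →
    avg (fun l => ∑ k ∈ Finset.Icc 1 n, kerB α t ρ n k * bdiff (fun m => u m l) k) i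
      = κ * lap ((b - a) / M) (fun l => fNl (u n l)) i
        + κ * ε ^ 2 * lap ((b - a) / M) (v n) i
  potential : ∀ n, 1 ≤ n → n ≤ N → ∀ i, 1 ≤ i → i ≤ M - 1 →
    avg (v n) i = -lap ((b - a) / M) (u n) i
  initial : ∀ i, 1 ≤ i → i ≤ M - 1 → u 0 i = u₀ (a + i * ((b - a) / M))

end TFCH

end

/-!
The energy law rests on three facts.

*Space.* On grid functions vanishing at the boundary `𝒜` and `-δ_x²` are commuting positive definite
matrices, so `-𝓗 = 𝒜⁻¹(-δ_x²)` is positive definite (`neg_calH_posDef`) and the scheme reads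
`∑ B_{n-k} ∇_τ u^k = -κ (-𝓗) (f(u^n) + ε² (-𝓗) u^n)` (`IsSchemeSolution.operator_form`). Pairing it
with `∇_τ u^n` in `(·, ·)_{-𝓗}` turns the right-hand side into `-κ (f(u^n) + ε² (-𝓗) u^n, ∇_τ u^n)`.
Since the double well potential is convex up to `-x² / 2`, and since
`‖φ‖² ≤ ε² ‖∇_h φ‖² + ‖φ‖²_{-𝓗} / (4 ε²)`, that pairing bounds the increment of the free energy up
to `‖∇_τ u^n‖²_{-𝓗} / (8 ε²)` (`freeEnergy_sub_le`).

*Time.* The left-hand side dominates the increment of `𝓖` plus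
`q / (2 τ_n^α Γ(3 - α)) ‖∇_τ u^n‖²_{-𝓗}` (`calG_sub_le`); the step size restriction makes the last
term absorb the remainder of the free energy estimate. The kernels `B` are the split kernels apart
from the last two positions of each row, which Young's inequality turns into `q` and the first term
of `𝓖`. The split kernels have a discrete gradient structure (`two_mul_sum_bilin`, `calGJ_sub_le`) as
soon as the entry of each row for the first step, and the differences of the entries for consecutive
steps, do not increase from one row to the next (`kerJ_first_le`, `kerJ_diff_le`).

*Kernels.* Up to a constant, `c` and `d` are the mean and the scaled first moment over a time step of
the power kernel `s ↦ (t_n - s)^{-α}`. The change of a kernel from one row to the next is thus a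
combination of means and moments of `g(s) = (t_{n-1} - s)^{-α} - (t_n - s)^{-α}`, which is
nonnegative, increasing and convex. For step ratios at least one, all the signs follow from
`le_mean_sub_moment` (monotonicity) and `mean_add_moment_le` (convexity), except where the diagonal
kernel `J` enters. There some moments are dropped, two equal steps are the worst case, and the claim
comes down to a lower bound for `1 - θ` in terms of `2^{-α}` (`le_two_mul_one_sub_theta`).
-/

open scoped BigOperators Matrix

noncomputable section

namespace TFCH

/-! ### Matrices of the space discretization -/

section

theorem tridiag_mulVec (M : ℕ) (d e : ℝ) (w : ℕ → ℝ) (h0 : w 0 = 0) (hM : w M = 0) :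
    (Matrix.of fun i j : Fin (M - 1) =>
      if i = j then d else if (i : ℕ) + 1 = j ∨ (j : ℕ) + 1 = i then e else 0) *ᵥ interiorVals M w
      = interiorVals M fun i => e * w (i - 1) + d * w i + e * w (i + 1) := by
  funext j
  have hj := j.2
  have key : ∀ i : Fin (M - 1),
      (if j = i then d else if (j : ℕ) + 1 = i ∨ (i : ℕ) + 1 = j then e else 0) * w (i + 1)
      = (if (j : ℕ) = i then d * w (i + 1) else 0)
        + (if (j : ℕ) + 1 = i then e * w (i + 1) else 0)
        + (if (j : ℕ) = i + 1 then e * w (i + 1) else 0) := by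
    intro i
    have : (j = i) ↔ (j : ℕ) = i := Fin.ext_iff
    simp only [this]
    split_ifs <;> first | omega | ring
  simp only [Matrix.mulVec, dotProduct, Matrix.of_apply, interiorVals, key]
  rw [Finset.sum_add_distrib, Finset.sum_add_distrib,
    Fin.sum_univ_eq_sum_range (fun i => if (j : ℕ) = i then d * w (i + 1) else 0),
    Fin.sum_univ_eq_sum_range (fun i => if (j : ℕ) + 1 = i then e * w (i + 1) else 0),
    Fin.sum_univ_eq_sum_range (fun i => if (j : ℕ) = i + 1 then e * w (i + 1) else 0),
    Finset.sum_ite_eq, Finset.sum_ite_eq, if_pos (Finset.mem_range.2 hj)]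
  have h2 : (if (j : ℕ) + 1 ∈ Finset.range (M - 1) then e * w (j + 1 + 1) else 0)
      = e * w (j + 1 + 1) := by
    split_ifs with h
    · rfl
    · rw [Finset.mem_range] at h
      have : (j : ℕ) + 1 + 1 = M := by omega
      rw [this, hM, mul_zero]
  have h3 : ∑ i ∈ Finset.range (M - 1), (if (j : ℕ) = i + 1 then e * w (i + 1) else 0)
      = e * w j := by
    rcases Nat.eq_zero_or_pos (j : ℕ) with h | h
    · rw [h, h0, mul_zero]
      exact Finset.sum_eq_zero fun i _ => if_neg (by omega)
    · rw [Finset.sum_eq_single ((j : ℕ) - 1)]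
      · rw [if_pos (by omega), Nat.sub_add_cancel h]
      · intro i _ hi
        exact if_neg (by omega)
      · intro hi
        exact absurd (Finset.mem_range.2 (by omega)) hi
  rw [h2, h3, Nat.add_sub_cancel]
  ring

theorem lapMat_mulVec (M : ℕ) (h : ℝ) (w : ℕ → ℝ) (h0 : w 0 = 0) (hM : w M = 0) :
    lapMat M h *ᵥ interiorVals M w = interiorVals M (lap h w) := by
  rw [lapMat, tridiag_mulVec M _ _ w h0 hM]
  funext j
  simp only [interiorVals, lap]
  ring

theorem avgMat_mulVec (M : ℕ) (w : ℕ → ℝ) (h0 : w 0 = 0) (hM : w M = 0) :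
    avgMat M *ᵥ interiorVals M w = interiorVals M (avg w) := by
  rw [avgMat, tridiag_mulVec M _ _ w h0 hM]
  funext j
  simp only [interiorVals, avg]
  ring

/-- Every vector of interior values extends by zero to a grid function. -/
theorem exists_interiorVals_eq {M : ℕ} (x : Fin (M - 1) → ℝ) :
    ∃ w : ℕ → ℝ, w 0 = 0 ∧ w M = 0 ∧ interiorVals M w = x := by
  refine ⟨fun i => if hi : 1 ≤ i ∧ i - 1 < M - 1 then x ⟨i - 1, hi.2⟩ else 0, ?_, ?_, ?_⟩
  · simp
  · exact dif_neg (by omega)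
  · funext j
    have := j.2
    simp [interiorVals]

/-- Summation by parts for the second difference. -/
theorem sum_mul_second_diff (w : ℕ → ℝ) (h0 : w 0 = 0) (K : ℕ) :
    ∑ i ∈ Finset.range K, w (i + 1) * (w i - 2 * w (i + 1) + w (i + 2))
      = w (K + 1) * (w (K + 1) - w K) - ∑ i ∈ Finset.range (K + 1), (w (i + 1) - w i) ^ 2 := by
  induction K with
  | zero => simp [h0]; ring
  | succ K ih =>
    rw [Finset.sum_range_succ, ih, Finset.sum_range_succ _ (K + 1)]
    ring

theorem avgMat_eq (M : ℕ) {h : ℝ} (hh : h ≠ 0) : avgMat M = 1 + (h ^ 2 / 12) • lapMat M h := by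
  ext i j
  simp only [avgMat, lapMat, Matrix.add_apply, Matrix.smul_apply, Matrix.of_apply, Matrix.one_apply,
    smul_eq_mul]
  split_ifs <;> field_simp <;> norm_num

theorem lapMat_isHermitian (M : ℕ) (h : ℝ) : (lapMat M h).IsHermitian := by
  ext i j
  simp only [lapMat, Matrix.conjTranspose_apply, Matrix.of_apply, star_trivial, eq_comm (a := j),
    or_comm (a := (j : ℕ) + 1 = i)]

theorem avgMat_isHermitian (M : ℕ) : (avgMat M).IsHermitian := by
  ext i j
  simp only [avgMat, Matrix.conjTranspose_apply, Matrix.of_apply, star_trivial, eq_comm (a := j),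
    or_comm (a := (j : ℕ) + 1 = i)]

theorem commute_avgMat_lapMat (M : ℕ) {h : ℝ} (hh : h ≠ 0) :
    Commute (avgMat M) (lapMat M h) := by
  rw [avgMat_eq M hh]
  exact (Commute.one_left _).add_left ((Commute.refl _).smul_left _)

/-- The quadratic form of `-δ_x²` is the sum of the squares of the first differences. -/
theorem dotProduct_lapMat {M : ℕ} (hM1 : 1 ≤ M) (h : ℝ) (w : ℕ → ℝ) (h0 : w 0 = 0) (hM : w M = 0) :
    interiorVals M w ⬝ᵥ (lapMat M h *ᵥ interiorVals M w)
      = -(∑ i ∈ Finset.range M, (w (i + 1) - w i) ^ 2) / h ^ 2 := by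
  rw [lapMat_mulVec M h w h0 hM]
  simp only [dotProduct, interiorVals, lap]
  rw [Fin.sum_univ_eq_sum_range
    (fun i => w (i + 1) * ((w (i + 1 - 1) - 2 * w (i + 1) + w (i + 1 + 1)) / h ^ 2))]
  have := sum_mul_second_diff w h0 (M - 1)
  rw [Nat.sub_add_cancel hM1, hM] at this
  simp only [Nat.add_sub_cancel, mul_div_assoc', ← Finset.sum_div]
  rw [this]
  ring

theorem neg_lapMat_posDef {M : ℕ} (hM1 : 1 ≤ M) {h : ℝ} (hh : 0 < h) : (-lapMat M h).PosDef := by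
  refine Matrix.PosDef.of_dotProduct_mulVec_pos (lapMat_isHermitian M h).neg fun x hx => ?_
  obtain ⟨w, h0, hM, rfl⟩ := exists_interiorVals_eq x
  rw [star_trivial, Matrix.neg_mulVec, dotProduct_neg, dotProduct_lapMat hM1 h w h0 hM, neg_div,
    neg_neg]
  refine div_pos ?_ (by positivity)
  by_contra hcon
  have hz : ∑ i ∈ Finset.range M, (w (i + 1) - w i) ^ 2 = 0 :=
    le_antisymm (not_lt.1 hcon) (Finset.sum_nonneg fun i _ => sq_nonneg _)
  rw [Finset.sum_eq_zero_iff_of_nonneg fun i _ => sq_nonneg _] at hz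
  have hw : ∀ i ≤ M, w i = 0 := by
    intro i
    induction i with
    | zero => intro _; exact h0
    | succ i ih =>
      intro hi
      have := pow_eq_zero_iff (two_ne_zero) |>.1 (hz i (Finset.mem_range.2 (by omega)))
      linarith [ih (by omega)]
  refine hx (funext fun j => hw _ ?_)
  have := j.2
  omega

theorem avgMat_posDef {M : ℕ} (hM1 : 1 ≤ M) : (avgMat M).PosDef := by
  refine Matrix.PosDef.of_dotProduct_mulVec_pos (avgMat_isHermitian M) fun x hx => ?_
  obtain ⟨w, h0, hM, rfl⟩ := exists_interiorVals_eq x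
  have hpos : 0 < interiorVals M w ⬝ᵥ interiorVals M w := by
    simpa using Matrix.dotProduct_star_self_pos_iff.2 hx
  rw [star_trivial, avgMat_eq M one_ne_zero, Matrix.add_mulVec, Matrix.one_mulVec, dotProduct_add,
    Matrix.smul_mulVec, dotProduct_smul, dotProduct_lapMat hM1 1 w h0 hM, smul_eq_mul]
  -- `(w_{i+1} - w_i)² ≤ 2 w_{i+1}² + 2 w_i²`, so the sum of squares is at most `4 ∑ w_i²`
  have hb : ∑ i ∈ Finset.range M, (w (i + 1) - w i) ^ 2
      ≤ 4 * (interiorVals M w ⬝ᵥ interiorVals M w) := by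
    have e1 : interiorVals M w ⬝ᵥ interiorVals M w
        = ∑ i ∈ Finset.range (M - 1), w (i + 1) ^ 2 := by
      simp only [dotProduct, interiorVals, ← sq]
      exact Fin.sum_univ_eq_sum_range (fun i => w (i + 1) ^ 2) (M - 1)
    have e2 : ∑ i ∈ Finset.range M, w (i + 1) ^ 2
        = ∑ i ∈ Finset.range (M - 1), w (i + 1) ^ 2 := by
      conv_lhs => rw [← Nat.sub_add_cancel hM1]
      rw [Finset.sum_range_succ, Nat.sub_add_cancel hM1, hM]
      ring
    have e3 : ∑ i ∈ Finset.range M, w i ^ 2 = ∑ i ∈ Finset.range (M - 1), w (i + 1) ^ 2 := by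
      conv_lhs => rw [← Nat.sub_add_cancel hM1]
      rw [Finset.sum_range_succ', h0]
      ring
    calc ∑ i ∈ Finset.range M, (w (i + 1) - w i) ^ 2
        ≤ ∑ i ∈ Finset.range M, (2 * w (i + 1) ^ 2 + 2 * w i ^ 2) :=
          Finset.sum_le_sum fun i _ => by nlinarith [sq_nonneg (w (i + 1) + w i)]
      _ = 4 * (interiorVals M w ⬝ᵥ interiorVals M w) := by
          rw [Finset.sum_add_distrib, ← Finset.mul_sum, ← Finset.mul_sum, e2, e3, e1]
          ring
  linarith

open scoped MatrixOrder in
theorem neg_calH_posDef {M : ℕ} (hM1 : 1 ≤ M) {h : ℝ} (hh : 0 < h) : (-calH M h).PosDef := by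
  have hA := avgMat_posDef hM1
  have hL := neg_lapMat_posDef hM1 hh
  have hu : IsUnit (avgMat M).det := (Matrix.isUnit_iff_isUnit_det _).1 hA.isUnit
  have hc : Commute (avgMat M)⁻¹ (-lapMat M h) := by
    have h1 : Commute (avgMat M) (-lapMat M h) :=
      (commute_avgMat_lapMat M hh.ne').neg_right
    calc (avgMat M)⁻¹ * -lapMat M h
        = (avgMat M)⁻¹ * (-lapMat M h * avgMat M) * (avgMat M)⁻¹ := by
          rw [Matrix.mul_assoc, Matrix.mul_nonsing_inv_cancel_right _ _ hu]
      _ = -lapMat M h * (avgMat M)⁻¹ := by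
          rw [← h1.eq, Matrix.nonsing_inv_mul_cancel_left _ _ hu]
  rw [calH, ← Matrix.mul_neg]
  rw [← Matrix.isStrictlyPositive_iff_posDef]
  exact (hA.inv.isStrictlyPositive.commute_iff hL.isStrictlyPositive).1 hc

end

/-! ### Means and first moments of monotone and convex functions -/

section

/-- The mean value of `g` over `[L, R]`. -/
def mean (g : ℝ → ℝ) (L R : ℝ) : ℝ := (R - L)⁻¹ * ∫ s in L..R, g s

/-- The scaled first moment `2 / (R - L)² ∫ (s - (L + R) / 2) g(s) ds` of `g` over `[L, R]`. -/
def moment (g : ℝ → ℝ) (L R : ℝ) : ℝ :=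
  2 / (R - L) ^ 2 * ∫ s in L..R, (s - (L + R) / 2) * g s

variable {f g : ℝ → ℝ} {L R : ℝ}

theorem mean_sub (hLR : L ≤ R) (hf : ContinuousOn f (Set.Icc L R))
    (hg : ContinuousOn g (Set.Icc L R)) :
    mean (fun s => f s - g s) L R = mean f L R - mean g L R := by
  rw [mean, mean, mean, intervalIntegral.integral_sub
    (hf.intervalIntegrable_of_Icc hLR) (hg.intervalIntegrable_of_Icc hLR), mul_sub]

theorem moment_sub (hLR : L ≤ R) (hf : ContinuousOn f (Set.Icc L R))
    (hg : ContinuousOn g (Set.Icc L R)) :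
    moment (fun s => f s - g s) L R = moment f L R - moment g L R := by
  have h1 : ContinuousOn (fun s => (s - (L + R) / 2) * f s) (Set.Icc L R) := by fun_prop
  have h2 : ContinuousOn (fun s => (s - (L + R) / 2) * g s) (Set.Icc L R) := by fun_prop
  rw [moment, moment, moment, ← mul_sub, ← intervalIntegral.integral_sub
    (h1.intervalIntegrable_of_Icc hLR) (h2.intervalIntegrable_of_Icc hLR)]
  simp only [mul_sub]

theorem integral_sub_mid (L R : ℝ) : ∫ s in L..R, (s - (L + R) / 2) = 0 := by
  rw [intervalIntegral.integral_sub (by simp) (by simp), integral_id,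
    intervalIntegral.integral_const, smul_eq_mul]
  ring

/-- The moment annihilates constants. -/
theorem moment_sub_const (hLR : L ≤ R) (hg : ContinuousOn g (Set.Icc L R)) (x : ℝ) :
    moment (fun s => g s - x) L R = moment g L R := by
  rw [moment_sub hLR hg continuousOn_const, sub_eq_self, moment,
    intervalIntegral.integral_mul_const, integral_sub_mid]
  ring

theorem moment_nonneg (hLR : L < R) (hg : ContinuousOn g (Set.Icc L R))
    (hmono : MonotoneOn g (Set.Icc L R)) : 0 ≤ moment g L R := by
  have hm : (L + R) / 2 ∈ Set.Icc L R := ⟨by linarith, by linarith⟩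
  rw [← moment_sub_const hLR.le hg (g ((L + R) / 2)), moment]
  refine mul_nonneg (by positivity) (intervalIntegral.integral_nonneg hLR.le fun s hs => ?_)
  rcases le_total s ((L + R) / 2) with h | h
  · exact mul_nonneg_of_nonpos_of_nonpos (by linarith) (by linarith [hmono hs hm h])
  · exact mul_nonneg (by linarith) (by linarith [hmono hm hs h])

theorem moment_le (hLR : L < R) (hg : ContinuousOn g (Set.Icc L R))
    (hmono : MonotoneOn g (Set.Icc L R)) : moment g L R ≤ g R - g L := by
  have hd : 0 < R - L := sub_pos.2 hLR
  rw [← moment_sub_const hLR.le hg (g L), moment]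
  have hc : ContinuousOn (fun s : ℝ => s - (L + R) / 2) (Set.Icc L R) := by fun_prop
  have : ∫ s in L..R, (s - (L + R) / 2) * (g s - g L)
      ≤ ∫ _ in L..R, (R - L) / 2 * (g R - g L) := by
    refine intervalIntegral.integral_mono_on hLR.le
      ((hc.mul (hg.sub continuousOn_const)).intervalIntegrable_of_Icc hLR.le) (by simp) fun s hs => ?_
    have h1 := hmono (Set.left_mem_Icc.2 hLR.le) hs hs.1
    have h2 := hmono hs (Set.right_mem_Icc.2 hLR.le) hs.2
    have h3 := hs.2
    exact mul_le_mul (by linarith) (by linarith) (by linarith) (by linarith)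
  rw [intervalIntegral.integral_const, smul_eq_mul] at this
  calc 2 / (R - L) ^ 2 * ∫ s in L..R, (s - (L + R) / 2) * (g s - g L)
      ≤ 2 / (R - L) ^ 2 * ((R - L) * ((R - L) / 2 * (g R - g L))) :=
        mul_le_mul_of_nonneg_left this (by positivity)
    _ = g R - g L := by field_simp

/-- For `c ≥ 1` the weight `1 / (R - L) - 2 (s - (L + R) / 2) / ((R - L)² (1 + c))` is nonnegative
and has mass one, so that a monotone function integrates against it to at least its value at `L`. -/
theorem le_mean_sub_moment (hLR : L < R) (hg : ContinuousOn g (Set.Icc L R))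
    (hmono : MonotoneOn g (Set.Icc L R)) {c : ℝ} (hc : 1 ≤ c) :
    g L ≤ mean g L R - moment g L R / (1 + c) := by
  have hd : 0 < R - L := sub_pos.2 hLR
  have hconst : mean (fun s => g s - g L) L R = mean g L R - g L := by
    rw [mean_sub hLR.le hg continuousOn_const, mean, mean, intervalIntegral.integral_const,
      smul_eq_mul, inv_mul_cancel_left₀ hd.ne']
  have hmom := moment_sub_const hLR.le hg (g L)
  have hcont : ContinuousOn (fun s : ℝ => s - (L + R) / 2) (Set.Icc L R) := by fun_prop
  have hgc : ContinuousOn (fun s => g s - g L) (Set.Icc L R) := hg.sub continuousOn_const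
  have hle : ∫ s in L..R, (s - (L + R) / 2) * (g s - g L)
      ≤ ∫ s in L..R, (R - L) / 2 * (g s - g L) := by
    refine intervalIntegral.integral_mono_on hLR.le
      ((hcont.mul hgc).intervalIntegrable_of_Icc hLR.le)
      ((continuousOn_const.mul hgc).intervalIntegrable_of_Icc hLR.le) fun s hs => ?_
    have h1 := hmono (Set.left_mem_Icc.2 hLR.le) hs hs.1
    have h3 := hs.2
    exact mul_le_mul_of_nonneg_right (by linarith) (by linarith)
  rw [intervalIntegral.integral_const_mul] at hle
  have h1 : moment g L R ≤ mean g L R - g L := by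
    rw [← hconst, ← hmom, moment, mean]
    calc 2 / (R - L) ^ 2 * ∫ s in L..R, (s - (L + R) / 2) * (g s - g L)
        ≤ 2 / (R - L) ^ 2 * ((R - L) / 2 * ∫ s in L..R, (g s - g L)) :=
          mul_le_mul_of_nonneg_left hle (by positivity)
      _ = (R - L)⁻¹ * ∫ s in L..R, (g s - g L) := by field_simp
  have h2 : moment g L R / (1 + c) ≤ moment g L R :=
    div_le_self (moment_nonneg hLR hg hmono) (by linarith)
  linarith

theorem le_mean (hLR : L < R) (hg : ContinuousOn g (Set.Icc L R))
    (hmono : MonotoneOn g (Set.Icc L R)) : g L ≤ mean g L R := by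
  have h1 := le_mean_sub_moment hLR hg hmono le_rfl
  have h2 := moment_nonneg hLR hg hmono
  linarith [div_nonneg h2 (by norm_num : (0 : ℝ) ≤ 1 + 1)]

theorem mean_le_of_convexOn (hLR : L < R) (hg : ContinuousOn g (Set.Icc L R))
    (hconv : ConvexOn ℝ (Set.Icc L R) g) : mean g L R ≤ (g L + g R) / 2 := by
  have hd : 0 < R - L := sub_pos.2 hLR
  have hle : ∫ s in L..R, g s
      ≤ ∫ s in L..R, ((g L + g R) / 2 + (g R - g L) / (R - L) * (s - (L + R) / 2)) := by
    refine intervalIntegral.integral_mono_on hLR.le (hg.intervalIntegrable_of_Icc hLR.le)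
      (Continuous.intervalIntegrable (by fun_prop) _ _) fun s hs => ?_
    have := hconv.2 (Set.left_mem_Icc.2 hLR.le) (Set.right_mem_Icc.2 hLR.le)
      (show 0 ≤ (R - s) / (R - L) from div_nonneg (by linarith [hs.2]) hd.le)
      (show 0 ≤ (s - L) / (R - L) from div_nonneg (by linarith [hs.1]) hd.le)
      (by field_simp; ring)
    simp only [smul_eq_mul] at this
    rw [show (R - s) / (R - L) * L + (s - L) / (R - L) * R = s by field_simp; ring] at this
    refine this.trans (le_of_eq ?_)
    field_simp
    ring
  rw [intervalIntegral.integral_add (by simp) (Continuous.intervalIntegrable (by fun_prop) _ _),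
    intervalIntegral.integral_const_mul, integral_sub_mid, intervalIntegral.integral_const,
    smul_eq_mul, mul_zero, add_zero] at hle
  calc mean g L R ≤ (R - L)⁻¹ * ((R - L) * ((g L + g R) / 2)) :=
        mul_le_mul_of_nonneg_left hle (by positivity)
    _ = (g L + g R) / 2 := by field_simp

/-- On adjacent intervals `[K, L]` and `[L, R]`, the second at least as long as the first, the
increment of a convex function over the second interval controls its moment over the first. -/
theorem mean_add_moment_le {K a : ℝ} (hKL : K < L) (hLR : L < R) (hlen : L - K ≤ R - L)
    (hg : ContinuousOn g (Set.Icc K R)) (hmono : MonotoneOn g (Set.Icc K R))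
    (hconv : ConvexOn ℝ (Set.Icc K R) g) (ha : 1 ≤ a) :
    mean g L R + moment g K L / (a * (1 + a)) ≤ g R := by
  have s1 : Set.Icc L R ⊆ Set.Icc K R := Set.Icc_subset_Icc_left hKL.le
  have s2 : Set.Icc K L ⊆ Set.Icc K R := Set.Icc_subset_Icc_right hLR.le
  have h1 := mean_le_of_convexOn hLR (hg.mono s1) (hconv.subset s1 (convex_Icc _ _))
  have h2 := moment_le hKL (hg.mono s2) (hmono.mono s2)
  have h3 : moment g K L / (a * (1 + a)) ≤ moment g K L / 2 :=
    div_le_div_of_nonneg_left (moment_nonneg hKL (hg.mono s2) (hmono.mono s2)) (by norm_num)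
      (by nlinarith)
  have hs := hconv.slope_mono_adjacent (x := K) (y := L) (z := R)
    ⟨le_rfl, (hKL.trans hLR).le⟩ ⟨(hKL.trans hLR).le, le_rfl⟩ hKL hLR
  have h4 : g L - g K ≤ g R - g L := by
    have hp : 0 ≤ (g R - g L) / (R - L) :=
      div_nonneg (sub_nonneg.2 (hmono ⟨hKL.le, hLR.le⟩ ⟨(hKL.trans hLR).le, le_rfl⟩ hLR.le))
        (sub_pos.2 hLR).le
    have a1 : g L - g K = (g L - g K) / (L - K) * (L - K) := by
      rw [div_mul_cancel₀ _ (sub_pos.2 hKL).ne']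
    have a2 : g R - g L = (g R - g L) / (R - L) * (R - L) := by
      rw [div_mul_cancel₀ _ (sub_pos.2 hLR).ne']
    rw [a1, a2]
    exact mul_le_mul hs hlen (sub_pos.2 hKL).le hp
  linarith

end

/-! ### The power kernel and the splitting parameter -/

section

/-- The power kernel `s ↦ (T - s)^p`; with `p = -α` it is, up to a constant, the kernel of the
Caputo derivative at time `T`. -/
def powKer (p T s : ℝ) : ℝ := (T - s) ^ p

/-- The decrease of the power kernel when the time moves from `T` to `T'`. -/
def powKerDiff (p T T' s : ℝ) : ℝ := powKer p T s - powKer p T' s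

theorem powKer_continuousOn (p T : ℝ) : ContinuousOn (powKer p T) (Set.Iio T) := by
  intro s hs
  exact ((continuousAt_const.sub continuousAt_id).rpow_const
    (Or.inl (sub_pos.2 hs).ne')).continuousWithinAt

theorem powKer_hasDerivAt (p : ℝ) {T s : ℝ} (hs : s < T) :
    HasDerivAt (powKer p T) (-p * powKer (p - 1) T s) s := by
  have h := ((hasDerivAt_id s).const_sub T).rpow_const (p := p) (Or.inl (sub_pos.2 hs).ne')
  refine h.congr_deriv ?_
  simp only [powKer, id]
  ring

theorem powKer_monotoneOn {p : ℝ} (hp : p ≤ 0) (T : ℝ) : MonotoneOn (powKer p T) (Set.Iio T) :=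
  fun _ _ _ hy hxy => Real.rpow_le_rpow_of_nonpos (sub_pos.2 hy) (by linarith) hp

theorem powKerDiff_nonneg {p T T' s : ℝ} (hp : p ≤ 0) (hT : T ≤ T') (hs : s < T) :
    0 ≤ powKerDiff p T T' s :=
  sub_nonneg.2 (Real.rpow_le_rpow_of_nonpos (sub_pos.2 hs) (by linarith) hp)

theorem powKerDiff_continuousOn (p : ℝ) {T T' : ℝ} (hT : T ≤ T') :
    ContinuousOn (powKerDiff p T T') (Set.Iio T) :=
  (powKer_continuousOn p T).sub ((powKer_continuousOn p T').mono (Set.Iio_subset_Iio hT))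

theorem powKerDiff_hasDerivAt (p : ℝ) {T T' s : ℝ} (hT : T ≤ T') (hs : s < T) :
    HasDerivAt (powKerDiff p T T') (-p * powKerDiff (p - 1) T T' s) s :=
  ((powKer_hasDerivAt p hs).sub (powKer_hasDerivAt p (hs.trans_le hT))).congr_deriv
    (by rw [powKerDiff, mul_sub])

theorem powKerDiff_monotoneOn {p T T' : ℝ} (hp : p ≤ 0) (hT : T ≤ T') :
    MonotoneOn (powKerDiff p T T') (Set.Iio T) := by
  refine monotoneOn_of_deriv_nonneg (convex_Iio T) (powKerDiff_continuousOn p hT) ?_ ?_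
  · rw [interior_Iio]
    exact fun s hs => (powKerDiff_hasDerivAt p hT hs).differentiableAt.differentiableWithinAt
  · rw [interior_Iio]
    intro s hs
    rw [(powKerDiff_hasDerivAt p hT hs).deriv]
    exact mul_nonneg (by linarith) (powKerDiff_nonneg (by linarith) hT hs)

theorem powKerDiff_convexOn {p T T' : ℝ} (hp : p ≤ 0) (hT : T ≤ T') :
    ConvexOn ℝ (Set.Iio T) (powKerDiff p T T') := by
  refine MonotoneOn.convexOn_of_deriv (convex_Iio T) (powKerDiff_continuousOn p hT) ?_ ?_
  · rw [interior_Iio]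
    exact fun s hs => (powKerDiff_hasDerivAt p hT hs).differentiableAt.differentiableWithinAt
  · rw [interior_Iio]
    intro x hx y hy hxy
    rw [(powKerDiff_hasDerivAt p hT hx).deriv, (powKerDiff_hasDerivAt p hT hy).deriv]
    exact mul_le_mul_of_nonneg_left (powKerDiff_monotoneOn (by linarith) hT hx hy hxy)
      (by linarith)

theorem mean_powKer {α L R T : ℝ} (hα : α < 1) :
    mean (powKer (-α) T) L R = ((T - L) ^ (1 - α) - (T - R) ^ (1 - α)) / ((R - L) * (1 - α)) := by
  rw [mean]
  simp only [powKer]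
  rw [intervalIntegral.integral_comp_sub_left (fun y : ℝ => y ^ (-α)) T,
    integral_rpow (Or.inl (by linarith)), show -α + 1 = 1 - α by ring]
  rw [← div_eq_inv_mul, div_div, mul_comm]

theorem moment_powKer {α L R T : ℝ} (hα : α < 1) (hLR : L < R) (hRT : R < T) :
    moment (powKer (-α) T) L R
      = 2 / (R - L) ^ 2 *
        ((T - (L + R) / 2) * (((T - L) ^ (1 - α) - (T - R) ^ (1 - α)) / (1 - α))
          - ((T - L) ^ (2 - α) - (T - R) ^ (2 - α)) / (2 - α)) := by
  rw [moment]
  congr 1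
  have h1 : ∫ s in L..R, (s - (L + R) / 2) * powKer (-α) T s
      = ∫ s in L..R, (fun y : ℝ => (T - (L + R) / 2) * y ^ (-α) - y ^ (1 - α)) (T - s) := by
    refine intervalIntegral.integral_congr fun s hs => ?_
    rw [Set.uIcc_of_le hLR.le] at hs
    have hy : 0 < T - s := by linarith [hs.2]
    simp only [powKer]
    rw [show 1 - α = 1 + -α by ring, Real.rpow_add hy, Real.rpow_one]
    ring
  rw [h1, intervalIntegral.integral_comp_sub_left
      (fun y : ℝ => (T - (L + R) / 2) * y ^ (-α) - y ^ (1 - α)) T,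
    intervalIntegral.integral_sub
      ((intervalIntegral.intervalIntegrable_rpow' (by linarith)).const_mul _)
      (intervalIntegral.intervalIntegrable_rpow' (by linarith)),
    intervalIntegral.integral_const_mul, integral_rpow (Or.inl (by linarith)),
    integral_rpow (Or.inl (by linarith)), show -α + 1 = 1 - α by ring,
    show 1 - α + 1 = 2 - α by ring]

theorem gamma_two_sub_pos {α : ℝ} (hα : α < 1) : 0 < Real.Gamma (2 - α) :=
  Real.Gamma_pos_of_pos (by linarith)

theorem gamma_three_sub {α : ℝ} (hα : α < 1) :
    Real.Gamma (3 - α) = (2 - α) * Real.Gamma (2 - α) := by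
  rw [← Real.Gamma_add_one (by linarith), show 2 - α + 1 = 3 - α by ring]

theorem kerC_eq_mean {α : ℝ} (hα : α < 1) (t : ℕ → ℝ) {n k : ℕ} :
    kerC α t n k
      = (1 - α) / Real.Gamma (2 - α) * mean (powKer (-α) (t n)) (t (k - 1)) (t k) := by
  have h1 : 1 - α ≠ 0 := by linarith
  have hG := (gamma_two_sub_pos hα).ne'
  rw [mean_powKer hα, kerC, tau]
  by_cases hτ : t k - t (k - 1) = 0
  · simp [hτ]
  · field_simp

theorem kerD_eq_moment {α : ℝ} (hα : α < 1) (t : ℕ → ℝ) {n k : ℕ} (hk : t (k - 1) < t k)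
    (hn : t k < t n) :
    kerD α t n k
      = (1 - α) / Real.Gamma (2 - α) * moment (powKer (-α) (t n)) (t (k - 1)) (t k) := by
  have h1 : 1 - α ≠ 0 := by linarith
  have h2 : 2 - α ≠ 0 := by linarith
  have hG := (gamma_two_sub_pos hα).ne'
  have hτ : t k - t (k - 1) ≠ 0 := by linarith
  have hA : 0 < t n - t (k - 1) := by linarith
  have hB : 0 < t n - t k := by linarith
  rw [moment_powKer hα hk hn, kerD, tau, gamma_three_sub hα]
  rw [show 2 - α = 1 + (1 - α) by ring, Real.rpow_add hA, Real.rpow_add hB, Real.rpow_one,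
    Real.rpow_one, ← show 2 - α = 1 + (1 - α) by ring]
  field_simp
  ring

/-- The right-hand side agrees with `2 ^ (-α)` at both ends, and `2 ^ (-α) - α² / 10` is convex. The
chord alone would not suffice for the bound on `θ` near `α = 0`. -/
theorem two_rpow_neg_le {α : ℝ} (h0 : 0 ≤ α) (h1 : α ≤ 1) :
    (2 : ℝ) ^ (-α) ≤ 1 - α / 2 - α * (1 - α) / 10 := by
  have hlog : 0.6931 < Real.log 2 := by linarith [Real.log_two_gt_d9]
  have hf : ∀ x : ℝ, HasDerivAt (fun x : ℝ => (2 : ℝ) ^ (-x) - x ^ 2 / 10)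
      (-(Real.log 2 * (2 : ℝ) ^ (-x)) - x / 5) x := by
    intro x
    have := ((hasDerivAt_neg x).const_rpow (a := 2) (by norm_num)).sub
      ((hasDerivAt_pow 2 x).div_const 10)
    refine this.congr_deriv ?_
    ring
  have hf2 : ∀ x : ℝ, HasDerivAt (fun x : ℝ => -(Real.log 2 * (2 : ℝ) ^ (-x)) - x / 5)
      (Real.log 2 ^ 2 * (2 : ℝ) ^ (-x) - 1 / 5) x := by
    intro x
    have := (((hasDerivAt_neg x).const_rpow (a := 2) (by norm_num)).const_mul (Real.log 2)).neg.sub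
      ((hasDerivAt_id x).div_const 5)
    refine this.congr_deriv ?_
    ring
  -- the second derivative is at least `(log 2)² / 2 - 1 / 5 > 0` on `[0, 1]`
  have hconv : ConvexOn ℝ (Set.Icc 0 1) (fun x : ℝ => (2 : ℝ) ^ (-x) - x ^ 2 / 10) := by
    refine MonotoneOn.convexOn_of_deriv (convex_Icc 0 1)
      (fun x _ => (hf x).continuousAt.continuousWithinAt)
      (fun x _ => (hf x).differentiableAt.differentiableWithinAt) ?_
    have hd : deriv (fun x : ℝ => (2 : ℝ) ^ (-x) - x ^ 2 / 10)
        = fun x : ℝ => -(Real.log 2 * (2 : ℝ) ^ (-x)) - x / 5 := funext fun x => (hf x).deriv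
    rw [hd]
    refine monotoneOn_of_deriv_nonneg (convex_Icc 0 1 |>.interior)
      (fun x _ => (hf2 x).continuousAt.continuousWithinAt)
      (fun x _ => (hf2 x).differentiableAt.differentiableWithinAt) ?_
    rw [interior_interior, interior_Icc]
    intro x hx
    rw [(hf2 x).deriv]
    have hX : (1 / 2 : ℝ) ≤ (2 : ℝ) ^ (-x) := by
      rw [show (1 / 2 : ℝ) = (2 : ℝ) ^ (-1 : ℝ) by rw [Real.rpow_neg_one]; norm_num]
      exact Real.rpow_le_rpow_of_exponent_le (by norm_num) (by linarith [hx.2])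
    nlinarith
  have := hconv.2 (Set.left_mem_Icc.2 zero_le_one) (Set.right_mem_Icc.2 zero_le_one)
    (sub_nonneg.2 h1) h0 (by ring)
  simp only [smul_eq_mul, mul_zero, mul_one, zero_add, neg_zero, Real.rpow_zero,
    Real.rpow_neg_one] at this
  linarith

/-- The lower bound for `2 (1 - θ)` that makes the last kernel `J` of a row large enough. -/
theorem le_two_mul_one_sub_theta {α ρbar : ℝ} (h0 : 0 < α) (h1 : α < 1)
    (hρ : |ρbar - 4.7476114| ≤ 1 / 10 ^ 7) :
    (1 - α) * (1 - (2 : ℝ) ^ (-α)) + ((2 : ℝ) ^ (1 - α) - 1) ≤ 2 * (1 - theta α ρbar) := by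
  have hX := two_rpow_neg_le h0.le h1.le
  have hX2 : (1 / 2 : ℝ) ≤ (2 : ℝ) ^ (-α) := by
    rw [show (1 / 2 : ℝ) = (2 : ℝ) ^ (-1 : ℝ) by rw [Real.rpow_neg_one]; norm_num]
    exact Real.rpow_le_rpow_of_exponent_le (by norm_num) (by linarith)
  rw [theta, show (1 - α : ℝ) = 1 + -α by ring, Real.rpow_add two_pos, Real.rpow_one,
    ← show (1 - α : ℝ) = 1 + -α by ring]
  set X := (2 : ℝ) ^ (-α)
  have hR : 5.747 ≤ 1 + ρbar := by
    have := (abs_le.1 hρ).1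
    norm_num at this ⊢
    linarith
  have hRpos : 0 < 1 + ρbar := by linarith
  have h2 : 0 < 2 - α := by linarith
  have hP : 0 ≤ 2 * X * α ^ 2 + α - 2 * α ^ 2 := by nlinarith [mul_pos h0 h0]
  have hq : (2 * X * α ^ 2 + α - 2 * α ^ 2) / (1 + ρbar)
      ≤ 0.175 * (2 * X * α ^ 2 + α - 2 * α ^ 2) := by
    rw [div_le_iff₀ hRpos]
    nlinarith
  have key : (2 - α) * ((1 - α) * (1 - X) + (2 * X - 1))
      ≤ 2 * (1 - α) - 0.175 * (2 * X * α ^ 2 + α - 2 * α ^ 2) := by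
    -- both sides are affine in `X`; at the upper bound for `X` they differ by
    -- `α (1 - α) (0.025 + 0.425 α - 0.065 α²)`
    have c1 : 0 ≤ (2 - α) * (1 + α) + 0.35 * α ^ 2 := by nlinarith
    have c2 := mul_le_mul_of_nonneg_left hX c1
    have c3 : 0 ≤ α * (1 - α) * (0.025 + 0.425 * α - 0.065 * α ^ 2) :=
      mul_nonneg (mul_nonneg h0.le (by linarith)) (by nlinarith)
    nlinarith
  have e : 2 * (1 - (1 / (2 - α)
        + (2 * X * α ^ 2 + α - 2 * α ^ 2) / (2 * (2 - α) * (1 + ρbar))))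
      = (2 * (1 - α) - (2 * X * α ^ 2 + α - 2 * α ^ 2) / (1 + ρbar)) / (2 - α) := by
    field_simp
    ring
  rw [e, le_div_iff₀ h2]
  linarith

/-- The mean of the next kernel over the current step, compared with its value at the left end of
the step. The next step being at least as long as the current one, the worst case is that of two
equal steps. -/
theorem mean_powKer_le {α ρbar L T T' : ℝ} (h0 : 0 < α) (h1 : α < 1)
    (hρ : |ρbar - 4.7476114| ≤ 1 / 10 ^ 7) (hLT : L < T) (hT' : T - L ≤ T' - T) :
    (1 - α) * (powKerDiff (-α) T T' L + mean (powKer (-α) T') L T)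
      ≤ 2 * (1 - theta α ρbar) * (T - L) ^ (-α) := by
  have hx : 0 < T - L := sub_pos.2 hLT
  set S := T + (T - L) with hS
  have hTS : T < S := by linarith
  have hST' : S ≤ T' := by linarith
  have hsub : Set.Icc L T ⊆ Set.Iio S := fun s hs => hs.2.trans_lt hTS
  have hsub' : Set.Icc L T ⊆ Set.Iio T' := fun s hs => hs.2.trans_lt (hTS.trans_le hST')
  have hm := le_mean hLT ((powKerDiff_continuousOn (-α) hST').mono hsub)
    ((powKerDiff_monotoneOn (by linarith) hST').mono hsub)
  have hms := mean_sub hLT.le ((powKer_continuousOn (-α) S).mono hsub)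
    ((powKer_continuousOn (-α) T').mono hsub')
  change mean (powKerDiff (-α) S T') L T = _ at hms
  rw [hms] at hm
  have h2x : S - L = 2 * (T - L) := by rw [hS]; ring
  have hval : powKer (-α) S L = (2 : ℝ) ^ (-α) * (T - L) ^ (-α) := by
    rw [powKer, h2x, Real.mul_rpow two_pos.le hx.le]
  have hmean : (1 - α) * mean (powKer (-α) S) L T = ((2 : ℝ) ^ (1 - α) - 1) * (T - L) ^ (-α) := by
    have h1' : 1 - α ≠ 0 := by linarith
    rw [mean_powKer h1, h2x, Real.mul_rpow two_pos.le hx.le, hS, add_sub_cancel_left,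
      show (T - L) ^ (1 - α) = (T - L) * (T - L) ^ (-α) by
        rw [show 1 - α = 1 + -α by ring, Real.rpow_add hx, Real.rpow_one]]
    field_simp
  have hθ := mul_le_mul_of_nonneg_right (le_two_mul_one_sub_theta h0 h1 hρ)
    (Real.rpow_nonneg hx.le (-α))
  have hfin : powKerDiff (-α) T T' L + mean (powKer (-α) T') L T
      ≤ (T - L) ^ (-α) - powKer (-α) S L + mean (powKer (-α) S) L T := by
    simp only [powKerDiff] at hm ⊢
    simp only [powKer] at hm ⊢
    linarith
  have := mul_le_mul_of_nonneg_left hfin (sub_pos.2 h1).le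
  rw [hval] at this
  linarith

end

/-! ### Monotonicity of the kernels from row to row -/

section

/-- A mesh `t 0 < ⋯ < t N` whose step sizes do not decrease, with step ratios `ρ k`, `2 ≤ k ≤ N`.
As in `rho`, the value `ρ 1` is zero; division by zero then removes the terms with the factor
`1 / (ρ 1 (1 + ρ 1))`, which belong to no step of the mesh. -/
structure IsExpandingMesh (t ρ : ℕ → ℝ) (N : ℕ) : Prop where
  lt : ∀ k, 1 ≤ k → k ≤ N → t (k - 1) < t k
  rho_one : ρ 1 = 0
  one_le_rho : ∀ k, 2 ≤ k → k ≤ N → 1 ≤ ρ k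
  tau_le : ∀ k, 2 ≤ k → k ≤ N → tau t (k - 1) ≤ tau t k

variable {α ρbar : ℝ} {t ρ : ℕ → ℝ} {N : ℕ}

theorem IsExpandingMesh.lt_of_lt (hm : IsExpandingMesh t ρ N) {i j : ℕ} (hij : i < j)
    (hj : j ≤ N) : t i < t j := by
  induction j, hij using Nat.le_induction with
  | base => exact hm.lt (i + 1) (by omega) hj
  | succ j h ih => exact (ih (by omega)).trans (hm.lt (j + 1) (by omega) hj)

theorem IsExpandingMesh.le_of_le (hm : IsExpandingMesh t ρ N) {i j : ℕ} (hij : i ≤ j)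
    (hj : j ≤ N) : t i ≤ t j := by
  rcases hij.eq_or_lt with rfl | h
  · exact le_rfl
  · exact (hm.lt_of_lt h hj).le

theorem kerCt_of_lt {n k : ℕ} (hρ1 : ρ 1 = 0) (hkn : k < n) :
    kerCt α ρbar t ρ n k
      = kerC α t n k + kerD α t n (k - 1) / (ρ k * (1 + ρ k)) - kerD α t n k / (1 + ρ (k + 1)) := by
  rw [kerCt, if_neg hkn.ne]
  split_ifs with h
  · subst h
    rw [hρ1]
    simp
  · rfl

theorem kerCt_self {n : ℕ} (hρ1 : ρ 1 = 0) :
    kerCt α ρbar t ρ n n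
      = (1 - theta α ρbar) * kerC α t n n + kerD α t n (n - 1) / (ρ n * (1 + ρ n)) := by
  rw [kerCt, if_pos rfl]
  split_ifs with h
  · subst h
    rw [hρ1]
    simp
  · rfl

/-- The contribution of the step before `t (k - 1)` to a row of kernels; it is empty for `k = 1`. -/
theorem kerD_div_eq (hm : IsExpandingMesh t ρ N) (hα : α < 1) {n k : ℕ} (hk : 1 ≤ k) (hkn : k ≤ n)
    (hn : n ≤ N) :
    kerD α t n (k - 1) / (ρ k * (1 + ρ k))
      = (1 - α) / Real.Gamma (2 - α)
        * (moment (powKer (-α) (t n)) (t (k - 1 - 1)) (t (k - 1)) / (ρ k * (1 + ρ k))) := by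
  rcases hk.eq_or_lt with rfl | h
  · simp [hm.rho_one]
  · rw [kerD_eq_moment hα t (hm.lt _ (by omega) (by omega)) (hm.lt_of_lt (by omega) hn),
      mul_div_assoc]

theorem kerJ_of_lt (hm : IsExpandingMesh t ρ N) (hα : α < 1) {n k : ℕ} (hk : 1 ≤ k) (hkn : k < n)
    (hn : n ≤ N) :
    kerJ α ρbar t ρ n k = (1 - α) / Real.Gamma (2 - α)
      * (mean (powKer (-α) (t n)) (t (k - 1)) (t k)
        + moment (powKer (-α) (t n)) (t (k - 1 - 1)) (t (k - 1)) / (ρ k * (1 + ρ k))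
        - moment (powKer (-α) (t n)) (t (k - 1)) (t k) / (1 + ρ (k + 1))) := by
  rw [kerJ, if_neg hkn.ne, kerCt_of_lt hm.rho_one hkn, kerD_div_eq hm hα hk hkn.le hn,
    kerC_eq_mean hα, kerD_eq_moment hα t (hm.lt _ hk (by omega)) (hm.lt_of_lt hkn hn)]
  ring

theorem kerJ_self (hm : IsExpandingMesh t ρ N) (hα : α < 1) {n : ℕ} (hn1 : 1 ≤ n) (hn : n ≤ N) :
    kerJ α ρbar t ρ n n = 1 / Real.Gamma (2 - α)
        * (2 * (1 - theta α ρbar) * (t n - t (n - 1)) ^ (-α))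
      + (1 - α) / Real.Gamma (2 - α)
        * (2 * moment (powKer (-α) (t n)) (t (n - 1 - 1)) (t (n - 1)) / (ρ n * (1 + ρ n))) := by
  have hx : 0 < t n - t (n - 1) := sub_pos.2 (hm.lt n hn1 hn)
  have hG := (gamma_two_sub_pos hα).ne'
  rw [kerJ, if_pos rfl, kerCt_self hm.rho_one, kerD_div_eq hm hα hn1 le_rfl hn, kerC, tau, sub_self,
    Real.zero_rpow (by linarith), show (1 - α : ℝ) = 1 + -α by ring, Real.rpow_add hx,
    Real.rpow_one]
  field_simp
  ring

theorem IsExpandingMesh.Icc_subset (hm : IsExpandingMesh t ρ N) {i k l : ℕ} (hkl : k < l)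
    (hl : l ≤ N) : Set.Icc (t i) (t k) ⊆ Set.Iio (t l) :=
  fun _ hs => hs.2.trans_lt (hm.lt_of_lt hkl hl)

theorem mean_powKerDiff (hm : IsExpandingMesh t ρ N) {i k l n : ℕ} (hik : i ≤ k) (hkl : k < l)
    (hln : l ≤ n) (hn : n ≤ N) :
    mean (powKerDiff (-α) (t l) (t n)) (t i) (t k)
      = mean (powKer (-α) (t l)) (t i) (t k) - mean (powKer (-α) (t n)) (t i) (t k) :=
  mean_sub (hm.le_of_le hik (by omega))
    ((powKer_continuousOn _ _).mono (hm.Icc_subset hkl (by omega)))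
    ((powKer_continuousOn _ _).mono (hm.Icc_subset (by omega) hn))

theorem moment_powKerDiff (hm : IsExpandingMesh t ρ N) {i k l n : ℕ} (hik : i ≤ k) (hkl : k < l)
    (hln : l ≤ n) (hn : n ≤ N) :
    moment (powKerDiff (-α) (t l) (t n)) (t i) (t k)
      = moment (powKer (-α) (t l)) (t i) (t k) - moment (powKer (-α) (t n)) (t i) (t k) :=
  moment_sub (hm.le_of_le hik (by omega))
    ((powKer_continuousOn _ _).mono (hm.Icc_subset hkl (by omega)))
    ((powKer_continuousOn _ _).mono (hm.Icc_subset (by omega) hn))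

theorem moment_powKerDiff_nonneg (hm : IsExpandingMesh t ρ N) (hα : 0 < α) {k l n : ℕ}
    (hk : 1 ≤ k) (hkl : k < l) (hln : l ≤ n) (hn : n ≤ N) :
    0 ≤ moment (powKerDiff (-α) (t l) (t n)) (t (k - 1)) (t k) := by
  have hT := hm.le_of_le hln hn
  have hs := hm.Icc_subset (i := k - 1) hkl (by omega)
  exact moment_nonneg (hm.lt k hk (by omega)) ((powKerDiff_continuousOn _ hT).mono hs)
    ((powKerDiff_monotoneOn (by linarith) hT).mono hs)

theorem moment_powKer_nonneg (hm : IsExpandingMesh t ρ N) (hα : 0 < α) {k n : ℕ}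
    (hk : 1 ≤ k) (hkn : k < n) (hn : n ≤ N) :
    0 ≤ moment (powKer (-α) (t n)) (t (k - 1)) (t k) := by
  have hs := hm.Icc_subset (i := k - 1) hkn hn
  exact moment_nonneg (hm.lt k hk (by omega)) ((powKer_continuousOn _ _).mono hs)
    ((powKer_monotoneOn (by linarith) _).mono hs)

theorem mean_add_moment_powKerDiff_le (hm : IsExpandingMesh t ρ N) (hα : 0 < α) {k l n : ℕ}
    (hk : 1 ≤ k) (hkl : k < l) (hln : l ≤ n) (hn : n ≤ N) :
    mean (powKerDiff (-α) (t l) (t n)) (t (k - 1)) (t k)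
      + moment (powKerDiff (-α) (t l) (t n)) (t (k - 1 - 1)) (t (k - 1)) / (ρ k * (1 + ρ k))
      ≤ powKerDiff (-α) (t l) (t n) (t k) := by
  have hT := hm.le_of_le hln hn
  have hα' : -α ≤ 0 := by linarith
  have hlt := hm.lt k hk (by omega)
  rcases hk.eq_or_lt with rfl | h
  · have hs := hm.Icc_subset (i := 1 - 1) hkl (by omega)
    have h1 := mean_le_of_convexOn hlt ((powKerDiff_continuousOn _ hT).mono hs)
      ((powKerDiff_convexOn hα' hT).subset hs (convex_Icc _ _))
    have h2 := powKerDiff_monotoneOn hα' hT (hs (Set.left_mem_Icc.2 hlt.le))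
      (hs (Set.right_mem_Icc.2 hlt.le)) hlt.le
    rw [hm.rho_one]
    simp only [zero_mul, div_zero, add_zero]
    linarith
  · have hs := hm.Icc_subset (i := k - 1 - 1) hkl (by omega)
    exact mean_add_moment_le (hm.lt (k - 1) (by omega) (by omega)) hlt
      (hm.tau_le k h (by omega)) ((powKerDiff_continuousOn _ hT).mono hs)
      ((powKerDiff_monotoneOn hα' hT).mono hs)
      ((powKerDiff_convexOn hα' hT).subset hs (convex_Icc _ _)) (hm.one_le_rho k h (by omega))

theorem le_mean_sub_moment_powKerDiff (hm : IsExpandingMesh t ρ N) (hα : 0 < α) {k l n : ℕ}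
    (hk : 1 ≤ k) (hkl : k < l) (hln : l ≤ n) (hn : n ≤ N) :
    powKerDiff (-α) (t l) (t n) (t (k - 1))
      ≤ mean (powKerDiff (-α) (t l) (t n)) (t (k - 1)) (t k)
        - moment (powKerDiff (-α) (t l) (t n)) (t (k - 1)) (t k) / (1 + ρ (k + 1)) := by
  have hT := hm.le_of_le hln hn
  have hs := hm.Icc_subset (i := k - 1) hkl (by omega)
  exact le_mean_sub_moment (hm.lt k hk (by omega)) ((powKerDiff_continuousOn _ hT).mono hs)
    ((powKerDiff_monotoneOn (by linarith) hT).mono hs) (hm.one_le_rho (k + 1) (by omega) (by omega))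

/-- The diagonal kernel without its moment term, compared with the next row. -/
theorem powKerDiff_add_mean_le (hm : IsExpandingMesh t ρ N) (h0 : 0 < α) (h1 : α < 1)
    (hρ : |ρbar - 4.7476114| ≤ 1 / 10 ^ 7) {m : ℕ} (hm1 : 1 ≤ m) (hmN : m + 1 ≤ N) :
    (1 - α) / Real.Gamma (2 - α) * (powKerDiff (-α) (t m) (t (m + 1)) (t (m - 1))
        + mean (powKer (-α) (t (m + 1))) (t (m - 1)) (t m))
      ≤ 1 / Real.Gamma (2 - α) * (2 * (1 - theta α ρbar) * (t m - t (m - 1)) ^ (-α)) := by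
  have hG := gamma_two_sub_pos h1
  have h := mean_powKer_le h0 h1 hρ (hm.lt m hm1 (by omega))
    (hm.tau_le (m + 1) (by omega) hmN)
  have := mul_le_mul_of_nonneg_left h (one_div_pos.2 hG).le
  calc _ = 1 / Real.Gamma (2 - α) * ((1 - α) * (powKerDiff (-α) (t m) (t (m + 1)) (t (m - 1))
        + mean (powKer (-α) (t (m + 1))) (t (m - 1)) (t m))) := by ring
    _ ≤ _ := this

/-- The row after the first one has to be compared with the doubled diagonal kernel. -/
theorem kerJ_first_le (hm : IsExpandingMesh t ρ N) (h0 : 0 < α) (h1 : α < 1)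
    (hρ : |ρbar - 4.7476114| ≤ 1 / 10 ^ 7) {m : ℕ} (hm1 : 1 ≤ m) (hmN : m + 1 ≤ N) :
    kerJ α ρbar t ρ (m + 1) 1 ≤ kerJ α ρbar t ρ m 1 := by
  have hK : 0 < (1 - α) / Real.Gamma (2 - α) :=
    div_pos (sub_pos.2 h1) (gamma_two_sub_pos h1)
  rcases hm1.eq_or_lt with rfl | h
  · have hb := powKerDiff_add_mean_le hm h0 h1 hρ le_rfl hmN
    have hd := powKerDiff_nonneg (p := -α) (by linarith) (hm.le_of_le (Nat.le_succ 1) hmN)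
      (hm.lt 1 le_rfl (by omega))
    have hmo : 0 ≤ moment (powKer (-α) (t (1 + 1))) (t (1 - 1)) (t 1) / (1 + ρ (1 + 1)) :=
      div_nonneg (moment_powKer_nonneg hm h0 le_rfl (by omega) hmN)
        (by linarith [hm.one_le_rho (1 + 1) le_rfl hmN])
    rw [kerJ_self hm h1 le_rfl (by omega), kerJ_of_lt hm h1 le_rfl (by omega) hmN, hm.rho_one]
    simp only [zero_mul, div_zero, mul_zero, add_zero]
    refine le_trans (mul_le_mul_of_nonneg_left ?_ hK.le) hb
    linarith
  · have hg := le_mean_sub_moment_powKerDiff hm h0 le_rfl h (Nat.le_succ m) hmN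
    have hd := powKerDiff_nonneg (p := -α) (by linarith) (hm.le_of_le (Nat.le_succ m) hmN)
      (hm.lt_of_lt (i := 1 - 1) (by omega) (by omega : m ≤ N))
    rw [mean_powKerDiff hm (by omega) h (Nat.le_succ m) hmN,
      moment_powKerDiff hm (by omega) h (Nat.le_succ m) hmN, sub_div] at hg
    rw [kerJ_of_lt hm h1 le_rfl h (by omega), kerJ_of_lt hm h1 le_rfl (by omega) hmN, hm.rho_one]
    refine mul_le_mul_of_nonneg_left ?_ hK.le
    simp only [zero_mul, div_zero, add_zero]
    linarith

/-- For `j + 1 < m` the step `j + 1` contributes at least `g (t j)` and the steps up to `j` take away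
at most that much, where `g` is the decrease of the kernel. For `j + 1 = m` the doubled diagonal
kernel takes the place of the former contribution. -/
theorem kerJ_diff_le (hm : IsExpandingMesh t ρ N) (h0 : 0 < α) (h1 : α < 1)
    (hρ : |ρbar - 4.7476114| ≤ 1 / 10 ^ 7) {m j : ℕ} (hj : 1 ≤ j) (hjm : j + 1 ≤ m)
    (hmN : m + 1 ≤ N) :
    kerJ α ρbar t ρ (m + 1) (j + 1) - kerJ α ρbar t ρ (m + 1) j
      ≤ kerJ α ρbar t ρ m (j + 1) - kerJ α ρbar t ρ m j := by
  have hK : 0 < (1 - α) / Real.Gamma (2 - α) :=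
    div_pos (sub_pos.2 h1) (gamma_two_sub_pos h1)
  have hp := hm.one_le_rho (j + 1) (by omega) (by omega)
  have hp1 : (1 + ρ (j + 1)) ≠ 0 := by linarith
  have hp0 : ρ (j + 1) ≠ 0 := by linarith
  -- the inequality for the step `j` and the one before it
  have hleft := mean_add_moment_powKerDiff_le hm h0 hj hjm (Nat.le_succ m) hmN
  rw [mean_powKerDiff hm (by omega) hjm (Nat.le_succ m) hmN,
    moment_powKerDiff hm (by omega) (by omega) (Nat.le_succ m) hmN, sub_div] at hleft
  have hmid := moment_powKerDiff_nonneg hm h0 hj hjm (Nat.le_succ m) hmN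
  rw [moment_powKerDiff hm (by omega) hjm (Nat.le_succ m) hmN] at hmid
  rw [kerJ_of_lt hm h1 (by omega) (by omega) hmN, kerJ_of_lt hm h1 hj (by omega) hmN,
    kerJ_of_lt hm h1 hj hjm (by omega)]
  simp only [Nat.add_sub_cancel]
  have comb : ∀ x : ℝ, x / (ρ (j + 1) * (1 + ρ (j + 1))) + x / (1 + ρ (j + 1)) = x / ρ (j + 1) := by
    intro x
    field_simp
  set P := moment (powKer (-α) (t m)) (t (j - 1)) (t j)
  set Q := moment (powKer (-α) (t (m + 1))) (t (j - 1)) (t j)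
  have hPQ : Q / ρ (j + 1) ≤ P / ρ (j + 1) :=
    div_le_div_of_nonneg_right (by linarith) (by linarith)
  have cP := comb P
  have cQ := comb Q
  rcases hjm.eq_or_lt with rfl | h
  · have hb := powKerDiff_add_mean_le hm h0 h1 hρ (m := j + 1) (by omega) hmN
    have hmo : 0 ≤ moment (powKer (-α) (t (j + 1 + 1))) (t j) (t (j + 1)) / (1 + ρ (j + 1 + 1)) :=
      div_nonneg (moment_powKer_nonneg hm h0 (k := j + 1) (by omega) (by omega) hmN)
        (by linarith [hm.one_le_rho (j + 1 + 1) (by omega) hmN])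
    have hP : 0 ≤ P / (ρ (j + 1) * (1 + ρ (j + 1))) :=
      div_nonneg (moment_powKer_nonneg hm h0 hj (by omega) (by omega)) (by positivity)
    rw [kerJ_self hm h1 (by omega) (by omega)]
    simp only [Nat.add_sub_cancel] at hb ⊢
    have hfin := mul_le_mul_of_nonneg_left
      (add_le_add (add_le_add hleft hPQ) (add_le_add hmo hP)) hK.le
    rw [← cP, ← cQ] at hfin
    rw [mul_div_assoc]
    linarith
  · have hright := le_mean_sub_moment_powKerDiff hm h0 (k := j + 1) (by omega) h
      (Nat.le_succ m) hmN
    rw [mean_powKerDiff hm (by omega) h (Nat.le_succ m) hmN,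
      moment_powKerDiff hm (by omega) h (Nat.le_succ m) hmN, sub_div] at hright
    rw [kerJ_of_lt hm h1 (by omega) h (by omega)]
    simp only [Nat.add_sub_cancel] at hright ⊢
    rw [← mul_sub, ← mul_sub]
    refine mul_le_mul_of_nonneg_left ?_ hK.le
    linarith

end

/-! ### The discrete gradient structure -/

section

/-- Summation by parts, with the values of `x` taken relative to an arbitrary reference `z`. -/
theorem sum_mul_sub_eq (c x : ℕ → ℝ) (m : ℕ) (z : ℝ) :
    ∑ k ∈ Finset.Icc 1 (m + 1), c k * (x k - x (k - 1))
      = c 1 * (z - x 0) + ∑ j ∈ Finset.Icc 1 m, (c (j + 1) - c j) * (z - x j)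
        - c (m + 1) * (z - x (m + 1)) := by
  induction m with
  | zero => simp; ring
  | succ m ih =>
    rw [Finset.sum_Icc_succ_top (by omega), ih, Finset.sum_Icc_succ_top (by omega : 1 ≤ m + 1),
      Nat.add_sub_cancel]
    ring

theorem sum_Icc_succ_sub (c : ℕ → ℝ) (m : ℕ) :
    ∑ j ∈ Finset.Icc 1 m, (c (j + 1) - c j) = c (m + 1) - c 1 := by
  induction m with
  | zero => simp
  | succ m ih =>
    rw [Finset.sum_Icc_succ_top (by omega), ih]
    ring

variable {V : Type*} [AddCommGroup V] [Module ℝ V] {B : LinearMap.BilinForm ℝ V}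

theorem two_mul_bilin_sub (hB : ∀ x y, B x y = B y x) (x y z : V) :
    2 * B (x - z) (x - y) = B (x - z) (x - z) - B (y - z) (y - z) + B (x - y) (x - y) := by
  simp only [map_sub, LinearMap.sub_apply]
  rw [hB y x, hB z x, hB z y]
  ring

/-- The discrete gradient structure of a convolution sum: paired with the last increment, it is a
combination of the changes of `‖w n - w j‖²` and the square of that increment. -/
theorem two_mul_sum_bilin (hB : ∀ x y, B x y = B y x) (c : ℕ → ℝ) (w : ℕ → V) (m : ℕ) :
    2 * ∑ k ∈ Finset.Icc 1 (m + 1), c k * B (bdiff w k) (bdiff w (m + 1))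
      = c 1 * (B (w (m + 1) - w 0) (w (m + 1) - w 0) - B (w m - w 0) (w m - w 0))
        + ∑ j ∈ Finset.Icc 1 m, (c (j + 1) - c j)
          * (B (w (m + 1) - w j) (w (m + 1) - w j) - B (w m - w j) (w m - w j))
        + c (m + 1) * B (bdiff w (m + 1)) (bdiff w (m + 1)) := by
  have e1 : ∑ k ∈ Finset.Icc 1 (m + 1), c k * B (bdiff w k) (bdiff w (m + 1))
      = ∑ k ∈ Finset.Icc 1 (m + 1), c k * ((fun j => B (w j) (bdiff w (m + 1))) k
          - (fun j => B (w j) (bdiff w (m + 1))) (k - 1)) :=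
    Finset.sum_congr rfl fun k _ => by
      rw [bdiff.eq_1 w k, map_sub, LinearMap.sub_apply]
  rw [e1, sum_mul_sub_eq c _ m (B (w (m + 1)) (bdiff w (m + 1))), sub_self, mul_zero, sub_zero,
    mul_add, Finset.mul_sum]
  have e2 : ∀ j, 2 * (B (w (m + 1)) (bdiff w (m + 1)) - B (w j) (bdiff w (m + 1)))
      = B (w (m + 1) - w j) (w (m + 1) - w j) - B (w m - w j) (w m - w j)
        + B (bdiff w (m + 1)) (bdiff w (m + 1)) := by
    intro j
    rw [← LinearMap.sub_apply, ← map_sub]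
    exact two_mul_bilin_sub hB (w (m + 1)) (w m) (w j)
  have e3 : ∑ j ∈ Finset.Icc 1 m,
        2 * ((c (j + 1) - c j) * (B (w (m + 1)) (bdiff w (m + 1)) - B (w j) (bdiff w (m + 1))))
      = ∑ j ∈ Finset.Icc 1 m, (c (j + 1) - c j)
          * (B (w (m + 1) - w j) (w (m + 1) - w j) - B (w m - w j) (w m - w j))
        + (c (m + 1) - c 1) * B (bdiff w (m + 1)) (bdiff w (m + 1)) := by
    rw [← sum_Icc_succ_sub c m, Finset.sum_mul, ← Finset.sum_add_distrib]
    refine Finset.sum_congr rfl fun j _ => ?_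
    rw [mul_left_comm, e2, mul_add]
  rw [e3, mul_left_comm, e2]
  ring

variable {α ρbar : ℝ} {t ρ : ℕ → ℝ} {N : ℕ}

/-- The part of `calG` that involves the kernels `J`. -/
def calGJ (sq : V → ℝ) (α ρbar : ℝ) (t ρ : ℕ → ℝ) (w : ℕ → V) (n : ℕ) : ℝ :=
  1 / 2 * ∑ j ∈ Finset.Icc 1 (n - 1),
      (kerJ α ρbar t ρ n (j + 1) - kerJ α ρbar t ρ n j) * sq (w n - w j)
    + 1 / 2 * kerJ α ρbar t ρ n 1 * sq (w n - w 0)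

theorem calGJ_sub_le (hB : ∀ x y, B x y = B y x) (hB0 : ∀ x, 0 ≤ B x x)
    (hm : IsExpandingMesh t ρ N) (h0 : 0 < α) (h1 : α < 1)
    (hρ : |ρbar - 4.7476114| ≤ 1 / 10 ^ 7) (w : ℕ → V) {m : ℕ} (hm1 : 1 ≤ m) (hmN : m + 1 ≤ N) :
    calGJ (fun x => B x x) α ρbar t ρ w (m + 1) - calGJ (fun x => B x x) α ρbar t ρ w m
      ≤ ∑ k ∈ Finset.Icc 1 (m + 1),
          kerCt α ρbar t ρ (m + 1) k * B (bdiff w k) (bdiff w (m + 1)) := by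
  have hJ : ∑ k ∈ Finset.Icc 1 (m + 1),
        kerJ α ρbar t ρ (m + 1) k * B (bdiff w k) (bdiff w (m + 1))
      = ∑ k ∈ Finset.Icc 1 (m + 1),
          kerCt α ρbar t ρ (m + 1) k * B (bdiff w k) (bdiff w (m + 1))
        + 1 / 2 * (kerJ α ρbar t ρ (m + 1) (m + 1)
          * B (bdiff w (m + 1)) (bdiff w (m + 1))) := by
    rw [Finset.sum_Icc_succ_top (by omega), Finset.sum_Icc_succ_top (by omega)]
    have : ∑ k ∈ Finset.Icc 1 m, kerJ α ρbar t ρ (m + 1) k * B (bdiff w k) (bdiff w (m + 1))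
        = ∑ k ∈ Finset.Icc 1 m,
          kerCt α ρbar t ρ (m + 1) k * B (bdiff w k) (bdiff w (m + 1)) :=
      Finset.sum_congr rfl fun k hk => by
        rw [kerJ, if_neg (by have := (Finset.mem_Icc.1 hk).2; omega)]
    rw [this, kerJ, if_pos rfl]
    ring
  have hab := two_mul_sum_bilin hB (kerJ α ρbar t ρ (m + 1)) w m
  -- the square for `j = m` vanishes at the earlier time
  have hsplit := Finset.sum_Icc_succ_top (a := 1) (b := m - 1) (by omega) fun j =>
    (kerJ α ρbar t ρ (m + 1) (j + 1) - kerJ α ρbar t ρ (m + 1) j) * B (w m - w j) (w m - w j)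
  rw [Nat.sub_add_cancel hm1, sub_self, map_zero, mul_zero, add_zero] at hsplit
  have hsum : ∑ j ∈ Finset.Icc 1 (m - 1),
        (kerJ α ρbar t ρ (m + 1) (j + 1) - kerJ α ρbar t ρ (m + 1) j) * B (w m - w j) (w m - w j)
      ≤ ∑ j ∈ Finset.Icc 1 (m - 1),
        (kerJ α ρbar t ρ m (j + 1) - kerJ α ρbar t ρ m j) * B (w m - w j) (w m - w j) := by
    refine Finset.sum_le_sum fun j hj => mul_le_mul_of_nonneg_right ?_ (hB0 _)
    obtain ⟨hj1, hj2⟩ := Finset.mem_Icc.1 hj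
    exact kerJ_diff_le hm h0 h1 hρ hj1 (by omega) hmN
  have hfirst := mul_le_mul_of_nonneg_right (kerJ_first_le hm h0 h1 hρ hm1 hmN) (hB0 (w m - w 0))
  simp only [mul_sub, Finset.sum_sub_distrib] at hab
  rw [calGJ, calGJ, Nat.add_sub_cancel]
  linarith

/-- The kernels `B` differ from the split kernels only in the last two positions. -/
theorem kerB_eq (hm : IsExpandingMesh t ρ N) {n k : ℕ} (hn : 2 ≤ n) (hk : 1 ≤ k) (hkn : k ≤ n) :
    kerB α t ρ n k = kerCt α ρbar t ρ n k
      + (if k = n then theta α ρbar * kerC α t n n + ρ n / (1 + ρ n) * kerD α t n n else 0)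
      - (if k = n - 1 then ρ n ^ 2 / (1 + ρ n) * kerD α t n n else 0) := by
  rcases hkn.eq_or_lt with rfl | h
  · rw [kerB, kerCt_self hm.rho_one, if_pos rfl, if_pos rfl, if_neg (by omega), if_neg (by omega)]
    ring
  · rw [kerCt_of_lt hm.rho_one h, kerB, if_neg h.ne, if_neg h.ne]
    by_cases hk1 : k = 1
    · subst hk1
      rw [if_pos rfl, hm.rho_one]
      by_cases hn2 : n = 2
      · subst hn2
        simp
      · rw [if_neg hn2, if_neg (by omega)]
        simp
    · rw [if_neg hk1]
      by_cases hk2 : k = n - 1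
      · rw [if_pos hk2, if_pos hk2, show k + 1 = n by omega]
        ring
      · rw [if_neg hk2, if_neg hk2]
        ring

theorem kerC_self (h1 : α < 1) {n : ℕ} (ht : t (n - 1) < t n) :
    kerC α t n n = (2 - α) * (1 / (tau t n ^ α * Real.Gamma (3 - α))) := by
  have hx : 0 < t n - t (n - 1) := sub_pos.2 ht
  have hxα := Real.rpow_pos_of_pos hx α
  have hG := (gamma_two_sub_pos h1).ne'
  have h2 : 2 - α ≠ 0 := by linarith
  rw [kerC, tau, sub_self, Real.zero_rpow (by linarith), Real.rpow_sub hx, Real.rpow_one,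
    gamma_three_sub h1]
  field_simp
  ring

theorem kerD_self (h1 : α < 1) {n : ℕ} (ht : t (n - 1) < t n) :
    kerD α t n n = α * (1 / (tau t n ^ α * Real.Gamma (3 - α))) := by
  have hx : 0 < t n - t (n - 1) := sub_pos.2 ht
  have hxα := Real.rpow_pos_of_pos hx α
  have hG := (gamma_two_sub_pos h1).ne'
  have h2 : 2 - α ≠ 0 := by linarith
  rw [kerD, tau, sub_self, Real.zero_rpow (by linarith), Real.zero_rpow (by linarith),
    Real.rpow_sub hx, Real.rpow_sub hx, Real.rpow_one, gamma_three_sub h1, Real.rpow_two]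
  field_simp
  ring

/-- Young's inequality with weights chosen so that the second term carries the previous step size
`x`: the current one is `z x`. -/
theorem young_step (hB : ∀ x y, B x y = B y x) (hB0 : ∀ x, 0 ≤ B x x) {x z : ℝ} (hx : 0 < x)
    (hz : 0 < z) (e' e : V) :
    z ^ 2 * (1 / (z * x) ^ α) * (2 * B e' e)
      ≤ z ^ (2 - α / 2) * (1 / (z * x) ^ α * B e e + 1 / x ^ α * B e' e') := by
  set s := z ^ (α / 2)
  have hs : 0 < s := Real.rpow_pos_of_pos hz _
  have hsq : z ^ α = s ^ 2 := by
    rw [← Real.rpow_natCast, ← Real.rpow_mul hz.le]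
    norm_num
  have hz2 : z ^ 2 = z ^ (2 - α / 2) * s := by
    rw [← Real.rpow_add hz, show 2 - α / 2 + α / 2 = (2 : ℕ) by norm_num, Real.rpow_natCast]
  have hsum := hB0 (e - s • e')
  simp only [map_sub, map_smul, LinearMap.sub_apply, LinearMap.smul_apply, smul_eq_mul] at hsum
  rw [hB e e'] at hsum
  have hxα := Real.rpow_pos_of_pos hx α
  have hE : 1 / x ^ α = 1 / (z * x) ^ α * s ^ 2 := by
    rw [Real.mul_rpow hz.le hx.le, hsq]
    field_simp
  rw [hE, hz2]
  have hw : 0 ≤ z ^ (2 - α / 2) * (1 / (z * x) ^ α) := by positivity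
  have := mul_le_mul_of_nonneg_left
    (show s * (2 * B e' e) ≤ B e e + s ^ 2 * B e' e' by linarith) hw
  linarith

theorem calG_sub_le (hB : ∀ x y, B x y = B y x) (hB0 : ∀ x, 0 ≤ B x x)
    (hm : IsExpandingMesh t ρ N) (h0 : 0 < α) (h1 : α < 1)
    (hρ : |ρbar - 4.7476114| ≤ 1 / 10 ^ 7) (w : ℕ → V) {m : ℕ} (hm1 : 1 ≤ m) (hmN : m + 1 ≤ N)
    (hratio : tau t (m + 1) = ρ (m + 1) * tau t m) :
    calG (fun x => B x x) α ρbar t ρ w (m + 1) - calG (fun x => B x x) α ρbar t ρ w m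
        + qFun α ρbar (ρ (m + 1)) (ρ (m + 1 + 1))
          / (2 * (tau t (m + 1) ^ α * Real.Gamma (3 - α)))
          * B (bdiff w (m + 1)) (bdiff w (m + 1))
      ≤ ∑ k ∈ Finset.Icc 1 (m + 1), kerB α t ρ (m + 1) k * B (bdiff w k) (bdiff w (m + 1)) := by
  have hJ := calGJ_sub_le hB hB0 hm h0 h1 hρ w hm1 hmN
  have hz : 1 ≤ ρ (m + 1) := hm.one_le_rho (m + 1) (by omega) hmN
  have htau : 0 < tau t m := sub_pos.2 (hm.lt m hm1 (by omega))
  have hG3 : 0 < Real.Gamma (3 - α) := Real.Gamma_pos_of_pos (by linarith)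
  have hy := young_step (α := α) hB hB0 htau (by linarith : 0 < ρ (m + 1)) (bdiff w m)
    (bdiff w (m + 1))
  rw [← hratio] at hy
  have hsum : ∑ k ∈ Finset.Icc 1 (m + 1), kerB α t ρ (m + 1) k * B (bdiff w k) (bdiff w (m + 1))
      = ∑ k ∈ Finset.Icc 1 (m + 1),
          kerCt α ρbar t ρ (m + 1) k * B (bdiff w k) (bdiff w (m + 1))
        + (theta α ρbar * kerC α t (m + 1) (m + 1)
            + ρ (m + 1) / (1 + ρ (m + 1)) * kerD α t (m + 1) (m + 1))
          * B (bdiff w (m + 1)) (bdiff w (m + 1))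
        - ρ (m + 1) ^ 2 / (1 + ρ (m + 1)) * kerD α t (m + 1) (m + 1)
          * B (bdiff w m) (bdiff w (m + 1)) := by
    rw [Finset.sum_congr rfl fun k hk => by
      rw [kerB_eq (ρbar := ρbar) hm (by omega : 2 ≤ m + 1) (Finset.mem_Icc.1 hk).1
        (Finset.mem_Icc.1 hk).2, sub_mul, add_mul, ite_mul, ite_mul, zero_mul]]
    rw [Finset.sum_sub_distrib, Finset.sum_add_distrib, Finset.sum_ite_eq', Finset.sum_ite_eq',
      if_pos (Finset.mem_Icc.2 ⟨by omega, le_rfl⟩),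
      if_pos (Finset.mem_Icc.2 ⟨by omega, by omega⟩), Nat.add_sub_cancel]
  have hlt := hm.lt (m + 1) (by omega) hmN
  rw [hsum, kerC_self h1 hlt, kerD_self h1 hlt, calG, calG, qFun]
  rw [calGJ, calGJ] at hJ
  set E := B (bdiff w (m + 1)) (bdiff w (m + 1))
  set E' := B (bdiff w m) (bdiff w m)
  set X := B (bdiff w m) (bdiff w (m + 1))
  have hzp : 0 < 1 + ρ (m + 1) := by linarith
  have hxp : 0 < tau t (m + 1) ^ α := Real.rpow_pos_of_pos (sub_pos.2 hlt) α
  have hxp' : 0 < tau t m ^ α := Real.rpow_pos_of_pos htau α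
  have hy2 := mul_le_mul_of_nonneg_left hy
    (show 0 ≤ α / (2 * (1 + ρ (m + 1)) * Real.Gamma (3 - α)) by positivity)
  have i1 : α / (2 * (1 + ρ (m + 1)) * Real.Gamma (3 - α))
        * (ρ (m + 1) ^ 2 * (1 / tau t (m + 1) ^ α) * (2 * X))
      = ρ (m + 1) ^ 2 / (1 + ρ (m + 1)) * (α * (1 / (tau t (m + 1) ^ α * Real.Gamma (3 - α)))) * X := by
    field_simp
  have i2 : α / (2 * (1 + ρ (m + 1)) * Real.Gamma (3 - α))
        * (ρ (m + 1) ^ (2 - α / 2) * (1 / tau t (m + 1) ^ α * E + 1 / tau t m ^ α * E'))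
      = α * ρ (m + 1) ^ (2 - α / 2) * E
          / (2 * (1 + ρ (m + 1)) * tau t (m + 1) ^ α * Real.Gamma (3 - α))
        + α * ρ (m + 1) ^ (2 - α / 2) * E'
          / (2 * (1 + ρ (m + 1)) * tau t m ^ α * Real.Gamma (3 - α)) := by
    field_simp
  rw [i1, i2] at hy2
  have i3 : α * ρ (m + 1 + 1) ^ (2 - α / 2) * E
        / (2 * (1 + ρ (m + 1 + 1)) * tau t (m + 1) ^ α * Real.Gamma (3 - α))
      + (2 * theta α ρbar * (2 - α)
          + (2 * α * ρ (m + 1) - α * ρ (m + 1) ^ (2 - α / 2)) / (1 + ρ (m + 1))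
          - α * ρ (m + 1 + 1) ^ (2 - α / 2) / (1 + ρ (m + 1 + 1)))
        / (2 * (tau t (m + 1) ^ α * Real.Gamma (3 - α))) * E
      = (theta α ρbar * ((2 - α) * (1 / (tau t (m + 1) ^ α * Real.Gamma (3 - α))))
          + ρ (m + 1) / (1 + ρ (m + 1)) * (α * (1 / (tau t (m + 1) ^ α * Real.Gamma (3 - α))))) * E
        - α * ρ (m + 1) ^ (2 - α / 2) * E
          / (2 * (1 + ρ (m + 1)) * tau t (m + 1) ^ α * Real.Gamma (3 - α)) := by
    have e1 : ∀ y d : ℝ, y / (2 * (1 + ρ (m + 1 + 1)) * d * Real.Gamma (3 - α))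
        = y / (1 + ρ (m + 1 + 1)) * (1 / (2 * (d * Real.Gamma (3 - α)))) := by
      intro y d
      rw [div_mul_div_comm, mul_one]
      congr 1
      ring
    rw [e1]
    generalize ρ (m + 1 + 1) ^ (2 - α / 2) = y
    rw [mul_right_comm α y E, mul_div_right_comm, mul_div_right_comm]
    field_simp
    ring
  linarith

end

/-! ### The free energy and the operator form of the scheme -/

section

/-- The inner product `(φ, ψ)_{-𝓗}` as a bilinear form. -/
def ipNegHForm (M : ℕ) (h : ℝ) : LinearMap.BilinForm ℝ (Fin (M - 1) → ℝ) :=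
  h • Matrix.toBilin' (-calH M h)⁻¹

theorem ipNegHForm_apply {M : ℕ} (h : ℝ) (φ ψ : Fin (M - 1) → ℝ) :
    ipNegHForm M h φ ψ = ipNegH h φ ψ := by
  rw [ipNegHForm, LinearMap.smul_apply, LinearMap.smul_apply, Matrix.toBilin'_apply', smul_eq_mul]
  rfl

theorem dotProduct_mulVec_comm {n : Type*} [Fintype n] {A : Matrix n n ℝ} (hA : A.IsHermitian)
    (x y : n → ℝ) : x ⬝ᵥ A *ᵥ y = y ⬝ᵥ A *ᵥ x := by
  have hT : Aᵀ = A := by rwa [Matrix.IsHermitian, Matrix.conjTranspose_eq_transpose_of_trivial] at hA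
  rw [Matrix.dotProduct_mulVec, ← Matrix.mulVec_transpose, hT, dotProduct_comm]

section NegHForm

variable {M : ℕ} {h : ℝ}

theorem ipNegHForm_symm (hM : 1 ≤ M) (hh : 0 < h) (φ ψ : Fin (M - 1) → ℝ) :
    ipNegHForm M h φ ψ = ipNegHForm M h ψ φ := by
  simp only [ipNegHForm_apply, ipNegH, ip]
  rw [show ∑ i, φ i * ((-calH M h)⁻¹ *ᵥ ψ) i = φ ⬝ᵥ (-calH M h)⁻¹ *ᵥ ψ from rfl,
    show ∑ i, ψ i * ((-calH M h)⁻¹ *ᵥ φ) i = ψ ⬝ᵥ (-calH M h)⁻¹ *ᵥ φ from rfl,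
    dotProduct_mulVec_comm (neg_calH_posDef hM hh).inv.isHermitian]

theorem ipNegHForm_nonneg (hM : 1 ≤ M) (hh : 0 < h) (φ : Fin (M - 1) → ℝ) :
    0 ≤ ipNegHForm M h φ φ := by
  rw [ipNegHForm_apply]
  refine mul_nonneg hh.le ?_
  have := (neg_calH_posDef hM hh).inv.posSemidef.dotProduct_mulVec_nonneg φ
  rwa [star_trivial] at this

/-- The operator `-𝓗` and the form `(·, ·)_{-𝓗}` are inverse to each other. -/
theorem ipNegHForm_mulVec (hM : 1 ≤ M) (hh : 0 < h) (φ ψ : Fin (M - 1) → ℝ) :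
    ipNegHForm M h ((-calH M h) *ᵥ φ) ψ = h * (φ ⬝ᵥ ψ) := by
  have hu := (Matrix.isUnit_iff_isUnit_det _).1 (neg_calH_posDef hM hh).isUnit
  rw [ipNegHForm_symm hM hh, ipNegHForm_apply, ipNegH, Matrix.mulVec_mulVec,
    Matrix.nonsing_inv_mul _ hu, Matrix.one_mulVec, ip, dotProduct_comm]
  rfl

theorem gradNormSq_eq (φ : Fin (M - 1) → ℝ) :
    gradNormSq h φ = h * (φ ⬝ᵥ (-calH M h) *ᵥ φ) := by
  rw [gradNormSq, ip, Matrix.neg_mulVec, dotProduct_neg, dotProduct_comm, mul_neg]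
  rfl

/-- The interpolation inequality `‖φ‖² ≤ ‖φ‖_{-𝓗} ‖∇_h φ‖`, in the form that Young's inequality
gives it. -/
theorem half_dotProduct_self_le (hM : 1 ≤ M) (hh : 0 < h) {ε : ℝ} (hε : 0 < ε)
    (φ : Fin (M - 1) → ℝ) :
    1 / 2 * (h * (φ ⬝ᵥ φ))
      ≤ ε ^ 2 / 2 * gradNormSq h φ + 1 / (8 * ε ^ 2) * ipNegHForm M h φ φ := by
  have hp := ipNegHForm_nonneg hM hh ((-calH M h) *ᵥ φ - (1 / (2 * ε ^ 2)) • φ)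
  simp only [map_sub, map_smul, LinearMap.sub_apply, LinearMap.smul_apply, smul_eq_mul] at hp
  rw [ipNegHForm_symm hM hh φ, ipNegHForm_mulVec hM hh, ipNegHForm_mulVec hM hh] at hp
  rw [gradNormSq_eq]
  have := mul_le_mul_of_nonneg_left hp (show 0 ≤ ε ^ 2 / 2 by positivity)
  have e : ε ^ 2 / 2 * (h * (φ ⬝ᵥ (-calH M h) *ᵥ φ) - 1 / (2 * ε ^ 2) * (h * (φ ⬝ᵥ φ))
        - 1 / (2 * ε ^ 2) * (h * (φ ⬝ᵥ φ) - 1 / (2 * ε ^ 2) * ipNegHForm M h φ φ))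
      = ε ^ 2 / 2 * (h * (φ ⬝ᵥ (-calH M h) *ᵥ φ)) - 1 / 2 * (h * (φ ⬝ᵥ φ))
        + 1 / (8 * ε ^ 2) * ipNegHForm M h φ φ := by
    field_simp
    ring
  rw [mul_zero, e] at this
  linarith

end NegHForm

/-- The double well potential `(x² - 1)² / 4` is convex up to the term `-x² / 2`. -/
theorem double_well_sub_le (x y : ℝ) :
    1 / 4 * (x ^ 2 - 1) ^ 2 - 1 / 4 * (y ^ 2 - 1) ^ 2
      ≤ fNl x * (x - y) + 1 / 2 * (x - y) ^ 2 := by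
  rw [fNl]
  nlinarith [sq_nonneg (x ^ 2 - y ^ 2), mul_nonneg (sq_nonneg x) (sq_nonneg (x - y))]

theorem freeEnergy_sub_le {M : ℕ} {h ε : ℝ} (hM : 1 ≤ M) (hh : 0 < h) (hε : 0 < ε)
    (φ ψ : Fin (M - 1) → ℝ) :
    freeEnergy h ε φ - freeEnergy h ε ψ
      ≤ h * (((fun i => fNl (φ i)) + ε ^ 2 • (-calH M h) *ᵥ φ) ⬝ᵥ (φ - ψ))
        + 1 / (8 * ε ^ 2) * ipNegHForm M h (φ - ψ) (φ - ψ) := by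
  have hwell : 1 / 4 * ip h (fun i => φ i ^ 2 - 1) (fun i => φ i ^ 2 - 1)
        - 1 / 4 * ip h (fun i => ψ i ^ 2 - 1) (fun i => ψ i ^ 2 - 1)
      ≤ h * ((fun i => fNl (φ i)) ⬝ᵥ (φ - ψ)) + 1 / 2 * (h * ((φ - ψ) ⬝ᵥ (φ - ψ))) := by
    have hs : ∑ i, (1 / 4 * (φ i ^ 2 - 1) ^ 2 - 1 / 4 * (ψ i ^ 2 - 1) ^ 2)
        ≤ ∑ i, (fNl (φ i) * (φ i - ψ i) + 1 / 2 * (φ i - ψ i) ^ 2) :=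
      Finset.sum_le_sum fun i _ => double_well_sub_le (φ i) (ψ i)
    rw [Finset.sum_sub_distrib, Finset.sum_add_distrib, ← Finset.mul_sum, ← Finset.mul_sum,
      ← Finset.mul_sum] at hs
    have := mul_le_mul_of_nonneg_left hs hh.le
    simp only [ip, dotProduct, Pi.sub_apply, ← sq]
    linarith
  have hgrad : gradNormSq h φ - gradNormSq h ψ
      = 2 * (h * (((-calH M h) *ᵥ φ) ⬝ᵥ (φ - ψ))) - gradNormSq h (φ - ψ) := by
    have hc := dotProduct_mulVec_comm (neg_calH_posDef hM hh).isHermitian φ ψ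
    rw [gradNormSq_eq, gradNormSq_eq, gradNormSq_eq]
    simp only [Matrix.mulVec_sub, dotProduct_sub, sub_dotProduct]
    rw [dotProduct_comm (-calH M h *ᵥ φ) φ, dotProduct_comm (-calH M h *ᵥ φ) ψ, hc]
    ring
  have hint := half_dotProduct_self_le hM hh hε (φ - ψ)
  rw [freeEnergy, freeEnergy, add_dotProduct, smul_dotProduct, smul_eq_mul]
  linear_combination hwell + hint + ε ^ 2 / 2 * hgrad

/-- The scheme in operator form: the discrete Caputo derivative of `u` is
`-κ (-𝓗) (f(uⁿ) + ε² (-𝓗) uⁿ)`. -/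
theorem IsSchemeSolution.operator_form {a b κ ε α : ℝ} {M N : ℕ} {t ρ : ℕ → ℝ} {u₀ : ℝ → ℝ}
    {u v : ℕ → ℕ → ℝ} (hsol : IsSchemeSolution a b M N κ ε α t ρ u₀ u v) (hM : 1 ≤ M)
    {n : ℕ} (hn1 : 1 ≤ n) (hn : n ≤ N) :
    ∑ k ∈ Finset.Icc 1 n, kerB α t ρ n k • bdiff (fun m => interiorVals M (u m)) k
      = (-calH M ((b - a) / M)) *ᵥ (-κ • ((fun i => fNl (interiorVals M (u n) i))
          + ε ^ 2 • (-calH M ((b - a) / M)) *ᵥ interiorVals M (u n))) := by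
  set h := (b - a) / M
  set U := interiorVals M (u n)
  set W : ℕ → ℝ := fun l => ∑ k ∈ Finset.Icc 1 n, kerB α t ρ n k * bdiff (fun m => u m l) k
  have hW : interiorVals M W
      = ∑ k ∈ Finset.Icc 1 n, kerB α t ρ n k • bdiff (fun m => interiorVals M (u m)) k := by
    funext j
    simp only [interiorVals, W, Finset.sum_apply, Pi.smul_apply, smul_eq_mul]
    rfl
  have hbd : ∀ l, (∀ k ≤ N, u k l = 0) → W l = 0 := by
    intro l hl
    refine Finset.sum_eq_zero fun k hk => ?_
    have := (Finset.mem_Icc.1 hk).2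
    rw [bdiff, hl k (by omega), hl (k - 1) (by omega), sub_zero, mul_zero]
  have hev : avgMat M *ᵥ interiorVals M W = κ • lapMat M h *ᵥ (fun i => fNl (U i))
      + (κ * ε ^ 2) • lapMat M h *ᵥ interiorVals M (v n) := by
    have hf : (fun i => fNl (U i)) = interiorVals M (fun l => fNl (u n l)) := rfl
    rw [avgMat_mulVec M W (hbd 0 hsol.u_left) (hbd M hsol.u_right), hf,
      lapMat_mulVec M h _ (by simp [hsol.u_left n hn, fNl]) (by simp [hsol.u_right n hn, fNl]),
      lapMat_mulVec M h _ (hsol.v_left n hn1 hn) (hsol.v_right n hn1 hn)]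
    funext j
    have := j.2
    exact hsol.evolution n hn1 hn (j + 1) (by omega) (by omega)
  have hpot : avgMat M *ᵥ interiorVals M (v n) = -(lapMat M h *ᵥ U) := by
    rw [avgMat_mulVec M _ (hsol.v_left n hn1 hn) (hsol.v_right n hn1 hn),
      lapMat_mulVec M h _ (hsol.u_left n hn) (hsol.u_right n hn)]
    funext j
    have := j.2
    exact hsol.potential n hn1 hn (j + 1) (by omega) (by omega)
  have hu := (Matrix.isUnit_iff_isUnit_det _).1 (avgMat_posDef hM).isUnit
  have hinv : ∀ x y : Fin (M - 1) → ℝ, avgMat M *ᵥ x = y → x = (avgMat M)⁻¹ *ᵥ y := by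
    intro x y hxy
    rw [← hxy, Matrix.mulVec_mulVec, Matrix.nonsing_inv_mul _ hu, Matrix.one_mulVec]
  have hv : interiorVals M (v n) = (-calH M h) *ᵥ U := by
    rw [hinv _ _ hpot, calH, Matrix.mulVec_neg, Matrix.mulVec_mulVec, Matrix.neg_mulVec]
  rw [← hW, hinv _ _ hev, hv, calH]
  simp only [Matrix.mulVec_add, Matrix.mulVec_smul, Matrix.neg_mulVec, Matrix.mulVec_neg,
    Matrix.mulVec_mulVec, smul_add, smul_neg, neg_smul, neg_neg, smul_smul]
  simp only [Matrix.mul_assoc, Matrix.neg_mulVec, neg_mul, neg_smul, smul_neg, neg_neg]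

end

end TFCH

end

theorem theorem4p5
    -- spatial interval, number of subintervals, physical parameters, fractional order
    (a b : ℝ) (hab : a < b) (M : ℕ) (hM : 1 ≤ M)
    (κ ε α : ℝ) (hκ : 0 < κ) (hε : 0 < ε) (hα0 : 0 < α) (hα1 : α < 1)
    -- time mesh with step ratios at least one, and the conventional value of the ratio `ρ_{N+1}`
    (N : ℕ) (hN : 1 ≤ N) (t : ℕ → ℝ) (ht0 : t 0 = 0)
    (ht : ∀ k, 1 ≤ k → k ≤ N → t (k - 1) < t k)
    (r : ℝ) (hr : 0 ≤ r)
    (hρ : ∀ k, 2 ≤ k → k ≤ N → 1 ≤ TFCH.rho t N r k)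
    -- the numerical constant in `θ`
    (ρbar : ℝ) (hρbar : |ρbar - 4.7476114| ≤ 1 / 10 ^ 7)
    -- a solution of the scheme
    (u₀ : ℝ → ℝ) (u v : ℕ → ℕ → ℝ)
    (hsol : TFCH.IsSchemeSolution a b M N κ ε α t (TFCH.rho t N r) u₀ u v)
    -- the solvability condition: a bound for the maximal step size
    (hsolv : ∀ n, 1 ≤ n → n ≤ N → ∀ k, 1 ≤ k → k ≤ N →
      TFCH.tau t k ≤
        ((2 - α + 2 * TFCH.rho t N r n) * ((b - a) / M) ^ 2
          / (12 * κ * (1 + TFCH.rho t N r n) * Real.Gamma (3 - α))) ^ (1 / α))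
    -- the step size restriction
    (hτ : ∀ n, 2 ≤ n → n ≤ N →
      TFCH.tau t n ^ α ≤
        4 * ε ^ 2 * TFCH.qFun α ρbar (TFCH.rho t N r n) (TFCH.rho t N r (n + 1))
          / (κ * Real.Gamma (3 - α))) :
    ∀ n, 2 ≤ n → n ≤ N →
      TFCH.modEnergy M ((b - a) / M) ε κ α ρbar t (TFCH.rho t N r) u n
        ≤ TFCH.modEnergy M ((b - a) / M) ε κ α ρbar t (TFCH.rho t N r) u (n - 1) := by
  intro n hn2 hnN
  obtain ⟨m, rfl⟩ : ∃ m, n = m + 1 := ⟨n - 1, by omega⟩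
  have hh : 0 < (b - a) / M := div_pos (sub_pos.2 hab) (by exact_mod_cast hM)
  have hratio : ∀ k, 2 ≤ k → k ≤ N →
      TFCH.rho t N r k = TFCH.tau t k / TFCH.tau t (k - 1) := fun k h1 h2 => by
    rw [TFCH.rho, if_neg (by omega), if_pos h2]
  have htau : ∀ k, 1 ≤ k → k ≤ N → 0 < TFCH.tau t k := fun k h1 h2 => sub_pos.2 (ht k h1 h2)
  have hmesh : TFCH.IsExpandingMesh t (TFCH.rho t N r) N :=
    { lt := ht
      rho_one := if_pos le_rfl
      one_le_rho := hρ
      tau_le := fun k h1 h2 => by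
        have := hρ k h1 h2
        rwa [hratio k h1 h2, one_le_div (htau _ (by omega) (by omega))] at this }
  have hG3 : 0 < Real.Gamma (3 - α) := Real.Gamma_pos_of_pos (by linarith)
  have hxp : 0 < TFCH.tau t (m + 1) ^ α := Real.rpow_pos_of_pos (htau _ (by omega) hnN) α
  have hgrad := TFCH.calG_sub_le (TFCH.ipNegHForm_symm hM hh) (TFCH.ipNegHForm_nonneg hM hh) hmesh
    hα0 hα1 hρbar (fun k => TFCH.interiorVals M (u k)) (m := m) (by omega) hnN (by
      rw [hratio (m + 1) hn2 hnN, Nat.add_sub_cancel,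
        div_mul_cancel₀ _ (htau m (by omega) (by omega)).ne'])
  have hop := hsol.operator_form hM (n := m + 1) (by omega) hnN
  have hfree := TFCH.freeEnergy_sub_le hM hh hε (TFCH.interiorVals M (u (m + 1)))
    (TFCH.interiorVals M (u m))
  have hres := hτ (m + 1) hn2 hnN
  have hE := TFCH.ipNegHForm_nonneg hM hh
    (TFCH.bdiff (fun k => TFCH.interiorVals M (u k)) (m + 1))
  have hpair : ∑ k ∈ Finset.Icc 1 (m + 1), TFCH.kerB α t (TFCH.rho t N r) (m + 1) k
        * TFCH.ipNegHForm M ((b - a) / M) (TFCH.bdiff (fun k => TFCH.interiorVals M (u k)) k)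
          (TFCH.bdiff (fun k => TFCH.interiorVals M (u k)) (m + 1))
      = -κ * ((b - a) / M * (((fun i => TFCH.fNl (TFCH.interiorVals M (u (m + 1)) i))
          + ε ^ 2 • (-TFCH.calH M ((b - a) / M)) *ᵥ TFCH.interiorVals M (u (m + 1)))
          ⬝ᵥ (TFCH.interiorVals M (u (m + 1)) - TFCH.interiorVals M (u m)))) := by
    have := congrArg (fun x => TFCH.ipNegHForm M ((b - a) / M) x
      (TFCH.bdiff (fun k => TFCH.interiorVals M (u k)) (m + 1))) hop
    simp only [TFCH.ipNegHForm_mulVec hM hh, map_sum, LinearMap.sum_apply, map_smul,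
      LinearMap.smul_apply, smul_eq_mul, smul_dotProduct] at this
    rw [this, mul_left_comm]
    rfl
  rw [hpair] at hgrad
  rw [TFCH.modEnergy, TFCH.modEnergy, Nat.add_sub_cancel]
  simp only [← TFCH.ipNegHForm_apply]
  set E := TFCH.ipNegHForm M ((b - a) / M)
    (TFCH.bdiff (fun k => TFCH.interiorVals M (u k)) (m + 1))
    (TFCH.bdiff (fun k => TFCH.interiorVals M (u k)) (m + 1)) with hEdef
  change _ ≤ _ + 1 / (8 * ε ^ 2) * E at hfree
  -- the step size restriction makes the quadratic remainder absorb `E / (8 ε²)`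
  have hq : κ / (8 * ε ^ 2) * E
      ≤ TFCH.qFun α ρbar (TFCH.rho t N r (m + 1)) (TFCH.rho t N r (m + 1 + 1))
        / (2 * (TFCH.tau t (m + 1) ^ α * Real.Gamma (3 - α))) * E := by
    refine mul_le_mul_of_nonneg_right ?_ hE
    rw [le_div_iff₀ (by positivity)] at hres
    rw [div_le_div_iff₀ (by positivity) (by positivity)]
    linarith
  have hmul := mul_le_mul_of_nonneg_left (add_le_add hgrad hq) (one_div_pos.2 hκ).le
  have hk : ∀ x : ℝ, 1 / κ * (-κ * x) = -x := fun x => by field_simp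
  have hk2 : 1 / κ * (κ / (8 * ε ^ 2) * E) = 1 / (8 * ε ^ 2) * E := by field_simp
  rw [mul_add, mul_add (1 / κ) (-κ * _), hk, hk2] at hmul
  linarith
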